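/- Let $d\ge 3$, $2^\star=\frac{2d}{d-2}$, and let $V:\mathbb R^d\to[0,\infty)$ be smooth with $V\in L^{d/2}(\mathbb R^d)$ and $\nabla V\in L^{d/2}(\mathbb R^d)$. Let $A=-\Delta+V$ be the operator on $L^2=L^2(\mathbb R^d;\mathbb C)$ with domain $D(A)=\{u\in H^1:\ -\Delta u+Vu\in L^2\}$ ($-\Delta u+Vu$ in the sense of distributions), and let $e^{itA}$ be the unitary group with generator $iA$. Assume the dispersive estimate: there is $C$ such that $\|e^{itA}f\|_{L^\infty}\le C|t|^{-d/2}\|f\|_{L^1}$ for all $t\ne 0$ and all $f\in L^1\cap L^2$. Write $\tau_af=f(\cdot-a)$ for $a\in\mathbb R^d$, $(u,v)_{L^2}=\int u\bar v$ and $(u,v)_{H^1}=\int u\bar v+\int\nabla u\cdot\nabla\bar v$. Then $A$ is self-adjoint, $iA$ does generate a (unique) strongly continuous unitary group $e^{itA}$ on $L^2$, and the following hold. 1. There are constants $c,C>0$ such that for all $u\in D(A)$ $$c\|u\|_{H^1}^2\le (Au,u)_{L^2}+\|u\|_{L^2}^2\le C\|u\|_{H^1}^2 .$$ 2. The form $B(u,v)=(Au,v)_{L^2}+(u,v)_{L^2}-(u,v)_{H^1}$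 on $D(A)\times D(A)$ extends uniquely to a bounded sesquilinear form $B$ on $H^1\times H^1$, and for every $\psi\in H^1$ and all sequences $x_n\in\mathbb R^d$, $h_n\in H^1$, one has $B(\tau_{x_n}\psi,\tau_{x_n}h_n)\to0$ as soon as either $|x_n|\to\infty$ and $\sup_n\|h_n\|_{H^1}<\infty$, or $x_n\to\bar x\in\mathbb R^d$ and $h_n\rightharpoonup0$ weakly in $H^1$. 3. For all sequences $t_n\in\mathbb R$, $x_n\in\mathbb R^d$ with $|t_n|\to\infty$, all $2<p\le 2^\star$ and all $\psi\in H^1$, $\|e^{it_nA}\tau_{x_n}\psi\|_{L^p}\to0$. 4. If $t_n\to\bar t\in\mathbb R$ and $|x_n|\to\infty$, then for every $\psi\in H^1$ there is $\varphi\in H^1$ such that $\tau_{-x_n}e^{it_nA}\tau_{x_n}\psi\to\varphi$ in $H^1$. 5. If $t_n\to\bar t\in\mathbb R$ and $x_n\to\bar x\in\mathbb R^d$, then for every $\psi\in H^1$, $e^{it_nA}\tau_{x_n}\psi\to e^{i\bar tA}\tau_{\bar x}\psi$ in $H^1$. -/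

import Mathlib

open MeasureTheory Filter Topology
open scoped ENNReal ContDiff Laplacian

noncomputable section

namespace Profile

/-! ### The spaces `L²(ℝᵈ; ℂ)` and `H¹(ℝᵈ; ℂ)` -/

/-- `ℝᵈ` with its Euclidean norm. -/
abbrev Space (d : ℕ) := EuclideanSpace ℝ (Fin d)

/-- The complex Hilbert space `L²(ℝᵈ; ℂ)`. Mathlib's inner product `inner ℂ v u` is linear in the
second variable, so the scalar product `(u, v) = ∫ u v̄` of the text is `inner ℂ v u`. -/
abbrev L2 (d : ℕ) := Lp ℂ 2 (volume : Measure (Space d))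

/-- Real-valued test functions `φ ∈ C_c^∞(ℝᵈ)`. -/
def IsTest {d : ℕ} (φ : Space d → ℝ) : Prop := ContDiff ℝ ∞ φ ∧ HasCompactSupport φ

/-- The partial derivative `∂_j φ`. -/
def partialDeriv {d : ℕ} (j : Fin d) (φ : Space d → ℝ) (x : Space d) : ℝ :=
  fderiv ℝ φ x (EuclideanSpace.single j 1)

/-- `g` is the weak `j`-th partial derivative of `u`: `∫ u ∂_jφ = - ∫ g φ` for all test `φ`. -/
def IsWeakPartial {d : ℕ} (j : Fin d) (u g : L2 d) : Prop :=
  ∀ φ : Space d → ℝ, IsTest φ → ∫ x, partialDeriv j φ x • u x = - ∫ x, φ x • g x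

theorem L2.integrable_smul {d : ℕ} (u : L2 d) {φ : Space d → ℝ} (hc : Continuous φ)
    (hs : HasCompactSupport φ) : Integrable (fun x => φ x • u x) :=
  ((Lp.memLp u).locallyIntegrable (by norm_num)).integrable_smul_left_of_hasCompactSupport hc hs

theorem IsTest.continuous_partialDeriv {d : ℕ} {φ : Space d → ℝ} (h : IsTest φ) (j : Fin d) :
    Continuous (partialDeriv j φ) :=
  (h.1.continuous_fderiv (by simp)).clm_apply continuous_const

theorem IsTest.hasCompactSupport_partialDeriv {d : ℕ} {φ : Space d → ℝ} (h : IsTest φ)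
    (j : Fin d) : HasCompactSupport (partialDeriv j φ) :=
  h.2.fderiv_apply ℝ (EuclideanSpace.single j 1)

/-- The Sobolev space `H¹(ℝᵈ; ℂ)`, realised as the space of pairs `(u, ∇u)` with
`u, ∂₁u, …, ∂_d u ∈ L²` (weak derivatives). As a subspace of the Hilbert product it carries the
norm `‖u‖² + ∑ ‖∂_j u‖²` and the corresponding inner product. -/
def sobolevH1 (d : ℕ) : Submodule ℂ (WithLp 2 (L2 d × PiLp 2 fun _ : Fin d => L2 d)) where
  carrier := {w | ∀ j, IsWeakPartial j w.fst (w.snd j)}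
  zero_mem' := by
    intro j φ hφ
    have h0 : ∀ᵐ x : Space d, (0 : L2 d) x = 0 := Lp.coeFn_zero _ _ _
    have h1 : ∫ x, partialDeriv j φ x • (0 : L2 d) x = 0 := by
      rw [integral_congr_ae (g := fun _ => (0 : ℂ)) (h0.mono fun x _ => by simp)]; simp
    have h2 : ∫ x, φ x • (0 : L2 d) x = 0 := by
      rw [integral_congr_ae (g := fun _ => (0 : ℂ)) (h0.mono fun x _ => by simp)]; simp
    exact h1.trans (by rw [← neg_zero, ← h2]; rfl)
  add_mem' := by
    intro v w hv hw j φ hφ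
    have e1 : ∫ x, partialDeriv j φ x • (v.fst + w.fst : L2 d) x
        = (∫ x, partialDeriv j φ x • v.fst x) + ∫ x, partialDeriv j φ x • w.fst x := by
      rw [← integral_add (L2.integrable_smul _ (hφ.continuous_partialDeriv j)
        (hφ.hasCompactSupport_partialDeriv j)) (L2.integrable_smul _ (hφ.continuous_partialDeriv j)
        (hφ.hasCompactSupport_partialDeriv j))]
      refine integral_congr_ae ((Lp.coeFn_add v.fst w.fst).mono fun x hx => ?_)
      simp only [hx, Pi.add_apply, smul_add]
    have e2 : ∫ x, φ x • (v.snd j + w.snd j : L2 d) x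
        = (∫ x, φ x • v.snd j x) + ∫ x, φ x • w.snd j x := by
      rw [← integral_add (L2.integrable_smul _ hφ.1.continuous hφ.2)
        (L2.integrable_smul _ hφ.1.continuous hφ.2)]
      refine integral_congr_ae ((Lp.coeFn_add (v.snd j) (w.snd j)).mono fun x hx => ?_)
      simp only [hx, Pi.add_apply, smul_add]
    refine e1.trans ?_
    rw [hv j φ hφ, hw j φ hφ, ← neg_add, ← e2]
    rfl
  smul_mem' := by
    intro c w hw j φ hφ
    have e1 : ∫ x, partialDeriv j φ x • (c • w.fst : L2 d) x
        = c • ∫ x, partialDeriv j φ x • w.fst x := by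
      rw [← integral_smul]
      refine integral_congr_ae ((Lp.coeFn_smul c w.fst).mono fun x hx => ?_)
      simp only [hx, Pi.smul_apply]
      rw [smul_comm]
    have e2 : ∫ x, φ x • (c • w.snd j : L2 d) x = c • ∫ x, φ x • w.snd j x := by
      rw [← integral_smul]
      refine integral_congr_ae ((Lp.coeFn_smul c (w.snd j)).mono fun x hx => ?_)
      simp only [hx, Pi.smul_apply]
      rw [smul_comm]
    refine e1.trans ?_
    rw [hw j φ hφ, smul_neg, ← e2]
    rfl

abbrev H1 (d : ℕ) := ↥(sobolevH1 d)

/-- The inclusion `H¹ ⊂ L²`. -/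
def H1.toL2 {d : ℕ} (w : H1 d) : L2 d := w.1.fst

/-- The weak derivative `∂_j w ∈ L²` of `w ∈ H¹`. -/
def H1.deriv {d : ℕ} (w : H1 d) (j : Fin d) : L2 d := w.1.snd j

theorem L2.eq_zero_of_test {d : ℕ} (u : L2 d)
    (h : ∀ φ : Space d → ℝ, IsTest φ → ∫ x, φ x • u x = 0) : u = 0 :=
  (Lp.eq_zero_iff_ae_eq_zero).2 (ae_eq_zero_of_integral_contDiff_smul_eq_zero
    ((Lp.memLp u).locallyIntegrable (by norm_num)) fun φ h1 h2 => h φ ⟨h1, h2⟩)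

theorem L2.eq_of_test {d : ℕ} (u v : L2 d)
    (h : ∀ φ : Space d → ℝ, IsTest φ → ∫ x, φ x • u x = ∫ x, φ x • v x) : u = v := by
  refine sub_eq_zero.1 (L2.eq_zero_of_test _ fun φ hφ => ?_)
  have : ∫ x, φ x • (u - v : L2 d) x = (∫ x, φ x • u x) - ∫ x, φ x • v x := by
    rw [← integral_sub (L2.integrable_smul _ hφ.1.continuous hφ.2)
      (L2.integrable_smul _ hφ.1.continuous hφ.2)]
    refine integral_congr_ae ((Lp.coeFn_sub u v).mono fun x hx => ?_)
    simp only [hx, Pi.sub_apply, smul_sub]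
  rw [this, h φ hφ, sub_self]

/-- An element of `H¹` is determined by the underlying `L²` function. -/
theorem H1.toL2_injective (d : ℕ) : Function.Injective (H1.toL2 (d := d)) := by
  intro v w h
  have hs : ∀ j, v.1.snd j = w.1.snd j := fun j => L2.eq_of_test _ _ fun φ hφ => by
    have h1 := v.2 j φ hφ
    have h2 := w.2 j φ hφ
    have h3 : v.1.fst = w.1.fst := h
    rw [h3, h2] at h1
    exact (neg_injective h1).symm
  apply Subtype.ext
  refine (WithLp.ofLp_injective 2) (Prod.ext h ?_)
  exact PiLp.ext hs

/-- The `H¹` norm is the usual one. -/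
theorem H1.norm_sq {d : ℕ} (w : H1 d) : ‖w‖ ^ 2 = ‖w.toL2‖ ^ 2 + ∑ j, ‖w.deriv j‖ ^ 2 := by
  have h1 := WithLp.prod_norm_sq_eq_of_L2 w.1
  have h2 := PiLp.norm_sq_eq_of_L2 (fun _ : Fin d => L2 d) w.1.snd
  rw [h2] at h1
  exact h1

/-! ### Translations `τ_a f = f(· - a)` -/

/-- `τ_a` on `L²`. -/
def translate {d : ℕ} (a : Space d) (f : L2 d) : L2 d :=
  Lp.compMeasurePreserving (fun y => y - a) (measurePreserving_sub_right volume a) f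

theorem coeFn_translate {d : ℕ} (a : Space d) (f : L2 d) :
    translate a f =ᵐ[volume] fun y => f (y - a) :=
  Lp.coeFn_compMeasurePreserving f (measurePreserving_sub_right volume a)

theorem integral_smul_translate {d : ℕ} (a : Space d) (f : L2 d) (φ : Space d → ℝ) :
    ∫ x, φ x • translate a f x = ∫ x, φ (x + a) • f x := by
  rw [← integral_sub_right_eq_self (fun x => φ (x + a) • f x) a]
  refine integral_congr_ae ((coeFn_translate a f).mono fun x hx => ?_)
  simp only [hx, sub_add_cancel]

theorem IsWeakPartial.translate {d : ℕ} {j : Fin d} {u g : L2 d} (h : IsWeakPartial j u g)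
    (a : Space d) : IsWeakPartial j (translate a u) (translate a g) := by
  intro φ hφ
  rw [integral_smul_translate, integral_smul_translate]
  have ht : IsTest fun x => φ (x + a) :=
    ⟨hφ.1.comp (contDiff_id.add contDiff_const),
      hφ.2.comp_homeomorph (Homeomorph.addRight a)⟩
  rw [← h _ ht]
  simp only [partialDeriv, fderiv_comp_add_right]

/-- `τ_a` on `H¹`. -/
def H1.translate {d : ℕ} (a : Space d) (w : H1 d) : H1 d :=
  ⟨WithLp.toLp 2 (Profile.translate a w.toL2,
      WithLp.toLp 2 fun j => Profile.translate a (w.deriv j)),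
    fun j => (w.2 j).translate a⟩

/-! ### The operator `-Δ + V` -/

theorem IsTest.continuous_laplacian {d : ℕ} {φ : Space d → ℝ} (h : IsTest φ) :
    Continuous (Δ φ) := by
  rw [InnerProductSpace.laplacian_eq_iteratedFDeriv_stdOrthonormalBasis]
  have := h.1.continuous_iteratedFDeriv (m := 2) (WithTop.coe_le_coe.2 le_top)
  fun_prop

theorem IsTest.hasCompactSupport_laplacian {d : ℕ} {φ : Space d → ℝ} (h : IsTest φ) :
    HasCompactSupport (Δ φ) := by
  refine (h.2.iteratedFDeriv (𝕜 := ℝ) 2).mono fun x hx => ?_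
  contrapose! hx
  simp only [Function.mem_support, ne_eq, not_not] at hx ⊢
  rw [InnerProductSpace.laplacian_eq_iteratedFDeriv_stdOrthonormalBasis]
  simp [hx]

/-- The graph of `-Δ + V`: pairs `(u, f)` with `u ∈ H¹`, `f ∈ L²` and `-Δu + Vu = f` in the sense
of distributions (`Vu` being locally integrable, which is automatic for continuous `V`). -/
def schrodingerGraph {d : ℕ} (V : Space d → ℝ) : Submodule ℂ (L2 d × L2 d) where
  carrier := {p | (∃ w : H1 d, w.toL2 = p.1) ∧ LocallyIntegrable (fun x => V x • p.1 x) ∧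
    ∀ φ : Space d → ℝ, IsTest φ →
      ∫ x, (-(Δ φ x) • p.1 x + φ x • (V x • p.1 x)) = ∫ x, φ x • p.2 x}
  zero_mem' := by
    have h0 : ∀ᵐ x : Space d, (0 : L2 d) x = 0 := Lp.coeFn_zero _ _ _
    refine ⟨⟨0, rfl⟩, ?_, fun φ _ => ?_⟩
    · have hz : LocallyIntegrable (fun _ : Space d => (0 : ℂ)) volume := locallyIntegrable_zero
      refine hz.congr (h0.mono fun x hx => ?_)
      simp only [Prod.fst_zero, hx, smul_zero]
    · refine integral_congr_ae (h0.mono fun x hx => ?_)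
      simp only [Prod.fst_zero, Prod.snd_zero, hx, smul_zero, add_zero]
  add_mem' := by
    rintro ⟨u, f⟩ ⟨v, g⟩ ⟨⟨wu, hwu⟩, hu, hf⟩ ⟨⟨wv, hwv⟩, hv, hg⟩
    simp only at hwu hu hf hwv hv hg
    have hadd := Lp.coeFn_add u v
    refine ⟨⟨wu + wv, by rw [← hwu, ← hwv]; rfl⟩, ?_, fun φ hφ => ?_⟩
    · refine (hu.add hv).congr (hadd.mono fun x hx => ?_)
      simp only [Prod.mk_add_mk, hx, Pi.add_apply, smul_add]
    · have i1 : ∀ w : L2 d, LocallyIntegrable (fun x => V x • w x) →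
          Integrable (fun x => -(Δ φ x) • w x + φ x • (V x • w x)) := fun w hw =>
        (L2.integrable_smul w hφ.continuous_laplacian.neg
          hφ.hasCompactSupport_laplacian.neg).add
          (hw.integrable_smul_left_of_hasCompactSupport hφ.1.continuous hφ.2)
      have e1 : ∫ x, φ x • (f + g : L2 d) x = (∫ x, φ x • f x) + ∫ x, φ x • g x := by
        rw [← integral_add (L2.integrable_smul _ hφ.1.continuous hφ.2)
          (L2.integrable_smul _ hφ.1.continuous hφ.2)]
        refine integral_congr_ae ((Lp.coeFn_add f g).mono fun x hx => ?_)
        simp only [hx, Pi.add_apply, smul_add]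
      simp only [Prod.mk_add_mk]
      rw [e1, ← hf φ hφ, ← hg φ hφ, ← integral_add (i1 u hu) (i1 v hv)]
      refine integral_congr_ae (hadd.mono fun x hx => ?_)
      simp only [hx, Pi.add_apply, smul_add]
      abel
  smul_mem' := by
    rintro c ⟨u, f⟩ ⟨⟨w, hw⟩, hu, hf⟩
    simp only at hw hu hf
    have hsm := Lp.coeFn_smul c u
    refine ⟨⟨c • w, by rw [← hw]; rfl⟩, ?_, fun φ hφ => ?_⟩
    · refine (hu.smul c).congr (hsm.mono fun x hx => ?_)
      simp only [Prod.smul_mk, hx, Pi.smul_apply]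
      rw [smul_comm]
    · have e1 : ∫ x, φ x • (c • f : L2 d) x = c • ∫ x, φ x • f x := by
        rw [← integral_smul]
        refine integral_congr_ae ((Lp.coeFn_smul c f).mono fun x hx => ?_)
        simp only [hx, Pi.smul_apply]
        rw [smul_comm]
      simp only [Prod.smul_mk]
      rw [e1, ← hf φ hφ, ← integral_smul]
      refine integral_congr_ae (hsm.mono fun x hx => ?_)
      simp only [hx, Pi.smul_apply, smul_add]
      rw [smul_comm, smul_comm (V x) c, smul_comm (φ x) c]

/-- The operator `A = -Δ + V` on `L²`, with domain `{u ∈ H¹ : -Δu + Vu ∈ L²}`. -/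
def schrodingerOp {d : ℕ} (V : Space d → ℝ) : L2 d →ₗ.[ℂ] L2 d :=
  (schrodingerGraph V).toLinearPMap

theorem schrodingerOp_graph {d : ℕ} (V : Space d → ℝ) :
    (schrodingerOp V).graph = schrodingerGraph V := by
  refine Submodule.toLinearPMap_graph_eq _ ?_
  rintro ⟨u, f⟩ ⟨_, _, h⟩ (rfl : u = 0)
  refine L2.eq_zero_of_test _ fun φ hφ => ?_
  rw [← h φ hφ]
  have h0 : ∀ᵐ x : Space d, (0 : L2 d) x = 0 := Lp.coeFn_zero _ _ _
  rw [integral_congr_ae (g := fun _ => (0 : ℂ)) (h0.mono fun x _ => by simp)]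
  simp

/-! ### The unitary group `e^{itA}` -/

/-- `U` is a strongly continuous one-parameter group of isometries whose infinitesimal generator is
exactly `iA`: `u ∈ D(A)` and `Au = f` if and only if `t ↦ U(t)u` has derivative `i f` at `0`. -/
structure IsUnitaryGroupOf {H : Type*} [NormedAddCommGroup H] [InnerProductSpace ℂ H]
    (A : H →ₗ.[ℂ] H) (U : ℝ → H →L[ℂ] H) : Prop where
  zero : U 0 = ContinuousLinearMap.id ℂ H
  add : ∀ s t, U (s + t) = (U s).comp (U t)
  norm : ∀ t u, ‖U t u‖ = ‖u‖
  continuous : ∀ u, Continuous fun t => U t u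
  generator : ∀ u f, (u, f) ∈ A.graph ↔ HasDerivAt (fun t => U t u) (Complex.I • f) 0

theorem IsUnitaryGroupOf.hasDerivAt {H : Type*} [NormedAddCommGroup H] [InnerProductSpace ℂ H]
    {A : H →ₗ.[ℂ] H} {U : ℝ → H →L[ℂ] H} (hU : IsUnitaryGroupOf A U) {u f : H}
    (h : (u, f) ∈ A.graph) (t : ℝ) :
    HasDerivAt (fun s => U s u) (Complex.I • U t f) t ∧ (U t u, U t f) ∈ A.graph := by
  have h0 := (hU.generator u f).1 h
  have h1 : HasDerivAt (fun s => U t (U s u)) (Complex.I • U t f) 0 := by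
    have := ((U t).restrictScalars ℝ).hasFDerivAt.comp_hasDerivAt (0 : ℝ) h0
    simpa [Function.comp_def] using this
  refine ⟨?_, (hU.generator _ _).2 ?_⟩
  · have h2 : HasDerivAt (fun s => U t (U s u)) (Complex.I • U t f) (t - t) := by
      rwa [sub_self]
    have h3 := h2.comp_sub_const t t
    refine h3.congr_of_eventuallyEq (Eventually.of_forall fun s => ?_)
    have := congrArg (fun T => T u) (hU.add t (s - t))
    simpa using this
  · refine h1.congr_of_eventuallyEq (Eventually.of_forall fun s => ?_)
    have e1 := congrArg (fun T => T u) (hU.add t s)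
    have e2 := congrArg (fun T => T u) (hU.add s t)
    rw [add_comm] at e2
    exact e2.symm.trans e1

/-- A densely defined operator generates at most one unitary group. -/
theorem IsUnitaryGroupOf.unique {H : Type*} [NormedAddCommGroup H] [InnerProductSpace ℂ H]
    {A : H →ₗ.[ℂ] H} (hA : Dense (A.domain : Set H)) {U W : ℝ → H →L[ℂ] H}
    (hU : IsUnitaryGroupOf A U) (hW : IsUnitaryGroupOf A W) : U = W := by
  have skew : ∀ x f y g : H, (x, f) ∈ A.graph → (y, g) ∈ A.graph →
      inner ℂ x (Complex.I • g) + inner ℂ (Complex.I • f) y = 0 := by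
    intro x f y g hx hy
    have h1 := (hU.hasDerivAt hx 0).1.inner ℂ (hU.hasDerivAt hy 0).1
    have h2 : (fun t => inner ℂ (U t x) (U t y)) = fun _ => inner ℂ x y := by
      funext t
      exact (LinearMap.norm_map_iff_inner_map_map (U t)).1 (hU.norm t) x y
    rw [h2] at h1
    have h3 := h1.unique (hasDerivAt_const _ _)
    rw [hU.zero] at h3
    exact h3
  funext t
  refine ContinuousLinearMap.ext fun v => ?_
  refine congrFun (Continuous.ext_on hA (U t).continuous (W t).continuous ?_) v
  intro u hu
  have hg : (u, A ⟨u, hu⟩) ∈ A.graph := A.mem_graph ⟨u, hu⟩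
  have hd : ∀ s, HasDerivAt (fun s => inner ℂ (U s u) (W s u)) 0 s := by
    intro s
    have h1 := (hU.hasDerivAt hg s).1.inner ℂ (hW.hasDerivAt hg s).1
    rwa [skew _ _ _ _ (hU.hasDerivAt hg s).2 (hW.hasDerivAt hg s).2] at h1
  have hc : inner ℂ (U t u) (W t u) = inner ℂ u u := by
    have := is_const_of_deriv_eq_zero (fun s => (hd s).differentiableAt)
      (fun s => (hd s).deriv) t 0
    simpa [hU.zero, hW.zero] using this
  rw [← sub_eq_zero, ← norm_eq_zero, ← sq_eq_zero_iff, @norm_sub_sq ℂ, hc, hU.norm, hW.norm,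
    inner_self_eq_norm_sq]
  ring

open Classical in
/-- The group `e^{itA}`. (The value `0` when `iA` generates no unitary group is irrelevant: that
`iA` generates `expI A` is part of the theorem.) -/
def expI {H : Type*} [NormedAddCommGroup H] [InnerProductSpace ℂ H]
    (A : H →ₗ.[ℂ] H) : ℝ → H →L[ℂ] H :=
  if h : ∃ U, IsUnitaryGroupOf A U then h.choose else 0

theorem expI_eq {H : Type*} [NormedAddCommGroup H] [InnerProductSpace ℂ H]
    {A : H →ₗ.[ℂ] H} (hA : Dense (A.domain : Set H)) {U : ℝ → H →L[ℂ] H}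
    (hU : IsUnitaryGroupOf A U) : expI A = U := by
  have h : ∃ U, IsUnitaryGroupOf A U := ⟨U, hU⟩
  rw [expI, dif_pos h]
  exact h.choose_spec.unique hA hU

/-- The pointwise dispersive estimate `‖e^{itA}‖_{L¹ → L^∞} ≲ |t|^{-d/2}`. -/
def DispersiveEstimate {d : ℕ} (A : L2 d →ₗ.[ℂ] L2 d) : Prop :=
  ∃ C : ℝ, ∀ t : ℝ, t ≠ 0 → ∀ f : L2 d, MemLp f 1 volume →
    eLpNorm (expI A t f) ∞ volume
      ≤ ENNReal.ofReal (C * |t| ^ (-(d / 2 : ℝ))) * eLpNorm f 1 volume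

/-! ### The hypotheses of the abstract profile decomposition -/

/-- `fₙ → φ` in `H¹`; this includes that all `fₙ` lie in `H¹`. -/
def TendstoH1 {d : ℕ} (f : ℕ → L2 d) (φ : H1 d) : Prop :=
  ∃ w : ℕ → H1 d, (∀ n, (w n).toL2 = f n) ∧ Tendsto w atTop (𝓝 φ)

/-- `hₙ ⇀ 0` weakly in `H¹`. -/
def WeaklyNullH1 {d : ℕ} (h : ℕ → H1 d) : Prop :=
  ∀ l : H1 d →L[ℂ] ℂ, Tendsto (fun n => l (h n)) atTop (𝓝 0)

/-- `D(A) ⊂ H¹` and `c ‖u‖²_{H¹} ≤ (Au, u) + ‖u‖²_{L²} ≤ C ‖u‖²_{H¹}` on `D(A)`. -/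
def NormEquivalence {d : ℕ} (A : L2 d →ₗ.[ℂ] L2 d) : Prop :=
  ∃ c C : ℝ, 0 < c ∧ 0 < C ∧ ∀ u : A.domain, ∃ w : H1 d, w.toL2 = u ∧
    c * ‖w‖ ^ 2 ≤ (inner ℂ (u : L2 d) (A u)).re + ‖(u : L2 d)‖ ^ 2 ∧
    (inner ℂ (u : L2 d) (A u)).re + ‖(u : L2 d)‖ ^ 2 ≤ C * ‖w‖ ^ 2

/-- `B` is a bounded sesquilinear form on `H¹` that extends
`(u, v) ↦ (Au, v) + (u, v)_{L²} - (u, v)_{H¹}`, given on `D(A) × D(A)`. -/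
def IsFormB {d : ℕ} (A : L2 d →ₗ.[ℂ] L2 d) (B : H1 d →L[ℂ] H1 d →L⋆[ℂ] ℂ) : Prop :=
  ∀ (u v : H1 d) (hu : u.toL2 ∈ A.domain), v.toL2 ∈ A.domain →
    B u v = inner ℂ v.toL2 (A ⟨u.toL2, hu⟩) + inner ℂ v.toL2 u.toL2 - inner ℂ v u

/-- The form `B` extends uniquely to `H¹ × H¹`, and `B(τ_{xₙ}ψ, τ_{xₙ}hₙ) → 0` for all `ψ ∈ H¹`
if either `|xₙ| → ∞` and `(hₙ)` is bounded in `H¹`, or `xₙ → x̄` and `hₙ ⇀ 0` in `H¹`. -/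
def FormVanishing {d : ℕ} (A : L2 d →ₗ.[ℂ] L2 d) : Prop :=
  (∃! B, IsFormB A B) ∧
  ∀ B, IsFormB A B → ∀ (x : ℕ → Space d) (h : ℕ → H1 d),
    ((Tendsto (fun n => ‖x n‖) atTop atTop ∧ ∃ M : ℝ, ∀ n, ‖h n‖ ≤ M) ∨
      ((∃ xbar, Tendsto x atTop (𝓝 xbar)) ∧ WeaklyNullH1 h)) →
    ∀ ψ : H1 d,
      Tendsto (fun n => B (H1.translate (x n) ψ) (H1.translate (x n) (h n))) atTop (𝓝 0)

/-- `|tₙ| → ∞` implies `‖e^{itₙA} τ_{xₙ}ψ‖_{L^p} → 0` for all `ψ ∈ H¹` and all finite `p` with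
`2 < p ≤ 2⋆`, that is `(d - 2) p ≤ 2 d`. -/
def DecayLp {d : ℕ} (A : L2 d →ₗ.[ℂ] L2 d) : Prop :=
  ∀ (t : ℕ → ℝ) (x : ℕ → Space d), Tendsto (fun n => |t n|) atTop atTop →
    ∀ p : ℝ, 2 < p → ((d : ℝ) - 2) * p ≤ 2 * d → ∀ ψ : H1 d,
      Tendsto (fun n => eLpNorm (expI A (t n) (translate (x n) ψ.toL2)) (ENNReal.ofReal p) volume)
        atTop (𝓝 0)

/-- `tₙ → t̄`, `|xₙ| → ∞` implies that `τ_{-xₙ} e^{itₙA} τ_{xₙ}ψ` converges in `H¹`. -/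
def ConvergenceAtInfinity {d : ℕ} (A : L2 d →ₗ.[ℂ] L2 d) : Prop :=
  ∀ (t : ℕ → ℝ) (x : ℕ → Space d) (tbar : ℝ), Tendsto t atTop (𝓝 tbar) →
    Tendsto (fun n => ‖x n‖) atTop atTop → ∀ ψ : H1 d, ∃ φ : H1 d,
      TendstoH1 (fun n => translate (-x n) (expI A (t n) (translate (x n) ψ.toL2))) φ

/-- `tₙ → t̄`, `xₙ → x̄` implies `e^{itₙA} τ_{xₙ}ψ → e^{it̄A} τ_{x̄}ψ` in `H¹`. -/
def ConvergenceAtFinite {d : ℕ} (A : L2 d →ₗ.[ℂ] L2 d) : Prop :=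
  ∀ (t : ℕ → ℝ) (x : ℕ → Space d) (tbar : ℝ) (xbar : Space d), Tendsto t atTop (𝓝 tbar) →
    Tendsto x atTop (𝓝 xbar) → ∀ ψ : H1 d, ∃ φ : H1 d,
      φ.toL2 = expI A tbar (translate xbar ψ.toL2) ∧
      TendstoH1 (fun n => expI A (t n) (translate (x n) ψ.toL2)) φ

end Profile

end

noncomputable section

namespace Profile

/-! ### Functional calculus of positive contractions -/

section Group

variable {H : Type*} [NormedAddCommGroup H] [InnerProductSpace ℂ H] [CompleteSpace H]

/-! Everything is read off from the quadratic form `‖w‖²_{H¹} + ‖√V w‖²_{L²}` on `H¹`. Since `√V ∈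
L^d` and `1/d + 1/2⋆ = 1/2`, Hölder and Sobolev make multiplication by `√V` a bounded operator `M :
H¹ → L²`. With `J : H¹ → L²` the inclusion, `R = J (1 + M*M)⁻¹ J*` is a positive contraction with
dense range. Test functions are dense in `H¹`, so the distributional equation is the weak equation
of the form, and `(u, f)` is in the graph of `A` exactly when `u = R (f + u)`; that is, `R = (1 +
A)⁻¹` (`mem_schrodingerGraph_iff`).

Self-adjointness of `A` follows from that of `R`. The function `r e^{it(1/r - 1)}` is continuous on
`[0, 1]`, so `R e^{itA}` is a continuous function of `R`, and `e^{itA}` is its isometric extension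
by density (`resolventGroup`). The group commutes with `R`, hence preserves the form: it lifts to
`H¹` with a bound uniform in time (`exists_resolventGroup_lift`).

The norm equivalence is the bound on `M`, and the form `B` is `(M u, M v)`. At infinity `B` vanishes
because `M τ_{xₙ} ψ → 0` in `L²` when `|xₙ| → ∞` (`tendsto_sobolevMul_translate`); at finite
distance the translations are moved to the other factor, which then converges strongly against a
weakly null sequence.

For the decay, `ψ` is approximated in `H¹` by a test function. That one lies in `L¹`, so the
dispersive estimate, interpolated with conservation of the `L²` norm, applies to it uniformly in the
translation; the remainder stays small in `L^p` by the uniform `H¹` bound and Sobolev.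

For the convergence statements, conjugating the group by `τ_{xₙ}` replaces `M` by `M τ_{xₙ}`. If
`|xₙ| → ∞` these tend strongly to `0`, the resolvents converge to that of `-Δ`, and the groups
converge in `L²` by Trotter-Kato. Conservation of the form makes the `H¹` norms converge as well,
and weak convergence with convergence of norms is strong convergence (`tendsto_of_form_le`). The
case `xₙ → x̄` uses the same argument with `M` fixed. -/

theorem spectrum_subset_unitInterval {R : H →L[ℂ] H} (h0 : 0 ≤ R) (h1 : R ≤ 1) {z : ℂ}
    (hz : z ∈ spectrum ℂ R) : ∃ r ∈ Set.Icc (0 : ℝ) 1, (r : ℂ) = z := by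
  have hsa : IsSelfAdjoint R := .of_nonneg h0
  have hz' : z = z.re := hsa.mem_spectrum_eq_re hz
  have hr : z.re ∈ spectrum ℝ R := by
    rw [hz'] at hz
    exact spectrum.of_algebraMap_mem ℂ hz
  exact ⟨z.re, ⟨spectrum_nonneg_of_nonneg h0 hr, (CFC.le_one_iff R).1 h1 _ hr⟩, hz'.symm⟩

theorem continuousOn_spectrum {R : H →L[ℂ] H} (h0 : 0 ≤ R) (h1 : R ≤ 1) {f : ℂ → ℂ}
    (hf : ContinuousOn (fun r : ℝ => f r) (Set.Icc 0 1)) : ContinuousOn f (spectrum ℂ R) := by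
  have h : ContinuousOn f (Complex.ofReal '' Set.Icc 0 1) := by
    have h2 : ContinuousOn (fun z : ℂ => f (z.re : ℂ)) (Complex.ofReal '' Set.Icc 0 1) := by
      refine hf.comp Complex.continuous_re.continuousOn ?_
      rintro _ ⟨r, hr, rfl⟩
      simpa using hr
    refine h2.congr ?_
    rintro _ ⟨r, hr, rfl⟩
    simp
  exact h.mono fun z hz => spectrum_subset_unitInterval h0 h1 hz

/-- The spectrum lies in `[0, 1]`, so operator estimates reduce to scalar inequalities for `r ∈ [0,
1]`. Every quantitative bound on the group comes from here. -/
theorem norm_cfc_sub_le {R : H →L[ℂ] H} (h0 : 0 ≤ R) (h1 : R ≤ 1) {f g : ℂ → ℂ}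
    (hf : ContinuousOn (fun r : ℝ => f r) (Set.Icc 0 1))
    (hg : ContinuousOn (fun r : ℝ => g r) (Set.Icc 0 1)) {c : ℝ} (hc : 0 ≤ c)
    (h : ∀ r ∈ Set.Icc (0 : ℝ) 1, ‖f r - g r‖ ≤ c) : ‖cfc f R - cfc g R‖ ≤ c := by
  rw [← cfc_sub f g R (continuousOn_spectrum h0 h1 hf) (continuousOn_spectrum h0 h1 hg)]
  refine norm_cfc_le hc fun z hz => ?_
  obtain ⟨r, hr, rfl⟩ := spectrum_subset_unitInterval h0 h1 hz
  exact h r hr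

/-- Weierstrass for the real and imaginary parts separately. The variable is real, so no conjugates
are needed in the approximating polynomial. -/
theorem exists_complex_polynomial_near {f : ℝ → ℂ} (hf : ContinuousOn f (Set.Icc 0 1)) {ε : ℝ}
    (hε : 0 < ε) : ∃ P : Polynomial ℂ, ∀ r ∈ Set.Icc (0 : ℝ) 1, ‖f r - P.eval (r : ℂ)‖ ≤ ε := by
  obtain ⟨p, hp⟩ := exists_polynomial_near_of_continuousOn 0 1 (fun r => (f r).re)
    (Complex.continuous_re.comp_continuousOn hf) (ε / 2) (by positivity)
  obtain ⟨q, hq⟩ := exists_polynomial_near_of_continuousOn 0 1 (fun r => (f r).im)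
    (Complex.continuous_im.comp_continuousOn hf) (ε / 2) (by positivity)
  refine ⟨p.map Complex.ofRealHom + Polynomial.C Complex.I * q.map Complex.ofRealHom,
    fun r hr => ?_⟩
  have e : ∀ s : Polynomial ℝ, (s.map Complex.ofRealHom).eval (r : ℂ) = (s.eval r : ℝ) := fun s =>
    Polynomial.eval_map_apply Complex.ofRealHom r
  rw [Polynomial.eval_add, Polynomial.eval_mul, Polynomial.eval_C, e, e]
  refine (Complex.norm_le_abs_re_add_abs_im _).trans ?_
  have h1 := hp r hr
  have h2 := hq r hr
  rw [abs_sub_comm] at h1 h2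
  simp only [Complex.sub_re, Complex.add_re, Complex.ofReal_re, Complex.mul_re, Complex.I_re,
    Complex.I_im, Complex.ofReal_im, Complex.sub_im, Complex.add_im, Complex.mul_im]
  ring_nf at h1 h2 ⊢
  linarith

/-- Under a uniform norm bound, strong convergence is stable under products; the rest is induction
on the polynomial. -/
theorem tendsto_aeval_apply {R : ℕ → H →L[ℂ] H} {S : H →L[ℂ] H} (hb : ∀ n, ‖R n‖ ≤ 1)
    (h : ∀ u, Tendsto (fun n => R n u) atTop (𝓝 (S u))) (P : Polynomial ℂ) (u : H) :
    Tendsto (fun n => Polynomial.aeval (R n) P u) atTop (𝓝 (Polynomial.aeval S P u)) := by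
  have key : ∀ v : ℕ → H, ∀ w, Tendsto v atTop (𝓝 w) →
      Tendsto (fun n => R n (v n)) atTop (𝓝 (S w)) := by
    intro v w hv
    have h1 : Tendsto (fun n => R n (v n - w)) atTop (𝓝 0) := by
      refine squeeze_zero_norm (fun n => ((R n).le_of_opNorm_le (hb n) _)) ?_
      simpa using (hv.sub_const w).norm
    simpa using h1.add (h w)
  induction P using Polynomial.induction_on with
  | C a => simp
  | add p q hp hq => simpa using hp.add hq
  | monomial n a ih =>
    have := key _ _ ih
    simp only [pow_succ', Polynomial.aeval_mul, Polynomial.aeval_X, Polynomial.aeval_C,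
      Polynomial.aeval_X_pow, mul_comm (Polynomial.C a)] at this ⊢
    have e : ∀ T : H →L[ℂ] H, T ((T ^ n * algebraMap ℂ (H →L[ℂ] H) a) u)
        = (T * T ^ n * algebraMap ℂ (H →L[ℂ] H) a) u := fun T => rfl
    simpa only [e] using this

theorem norm_le_one_of_nonneg {R : H →L[ℂ] H} (h0 : 0 ≤ R) (h1 : R ≤ 1) : ‖R‖ ≤ 1 := by
  have := CStarAlgebra.norm_le_norm_of_nonneg_of_le h0 h1
  exact this.trans ContinuousLinearMap.norm_id_le

/-- Strong convergence of positive contractions passes to continuous functions of them. -/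
theorem tendsto_cfc_apply {R : ℕ → H →L[ℂ] H} {S : H →L[ℂ] H} (h0 : ∀ n, 0 ≤ R n)
    (h1 : ∀ n, R n ≤ 1) (hS0 : 0 ≤ S) (hS1 : S ≤ 1)
    (h : ∀ u, Tendsto (fun n => R n u) atTop (𝓝 (S u))) {f : ℂ → ℂ}
    (hf : ContinuousOn (fun r : ℝ => f r) (Set.Icc 0 1)) (u : H) :
    Tendsto (fun n => cfc f (R n) u) atTop (𝓝 (cfc f S u)) := by
  rw [Metric.tendsto_atTop]
  intro ε hε
  have hδ : 0 < ε / (4 * (‖u‖ + 1)) := by positivity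
  obtain ⟨P, hP⟩ := exists_complex_polynomial_near hf hδ
  have hPc : ContinuousOn (fun r : ℝ => P.eval (r : ℂ)) (Set.Icc 0 1) := by fun_prop
  -- The polynomial error is uniform over all positive contractions, hence over the whole sequence
  -- and its limit.
  have near : ∀ T : H →L[ℂ] H, 0 ≤ T → T ≤ 1 →
      ‖cfc f T u - Polynomial.aeval T P u‖ ≤ ε / 4 := by
    intro T hT0 hT1
    have hT : IsSelfAdjoint T := .of_nonneg hT0
    have := norm_cfc_sub_le hT0 hT1 (g := fun z => P.eval z) hf hPc hδ.le hP
    rw [cfc_polynomial P T hT.isStarNormal] at this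
    calc _ ≤ ε / (4 * (‖u‖ + 1)) * ‖u‖ := (cfc f T - Polynomial.aeval T P).le_of_opNorm_le this u
      _ ≤ ε / (4 * (‖u‖ + 1)) * (‖u‖ + 1) := by gcongr; linarith
      _ = ε / 4 := by field_simp
  obtain ⟨N, hN⟩ := Metric.tendsto_atTop.1 (tendsto_aeval_apply
    (fun n => norm_le_one_of_nonneg (h0 n) (h1 n)) h P u) (ε / 4) (by positivity)
  refine ⟨N, fun n hn => ?_⟩
  have a1 := near _ (h0 n) (h1 n)
  have a2 := near _ hS0 hS1
  have a3 := hN n hn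
  rw [dist_eq_norm] at a3 ⊢
  rw [norm_sub_rev] at a2
  have : cfc f (R n) u - cfc f S u = (cfc f (R n) u - Polynomial.aeval (R n) P u)
    + (Polynomial.aeval (R n) P u - Polynomial.aeval S P u)
    + (Polynomial.aeval S P u - cfc f S u) := by abel
  rw [this]
  refine (norm_add₃_le).trans_lt ?_
  linarith

/-- The function `r ↦ e^{it(1/r - 1)}`. -/
def phase (t : ℝ) (z : ℂ) : ℂ := Complex.exp (Complex.I * (t * (z.re⁻¹ - 1) : ℝ))

theorem norm_phase (t : ℝ) (z : ℂ) : ‖phase t z‖ = 1 := by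
  rw [phase, mul_comm]; exact Complex.norm_exp_ofReal_mul_I _

theorem phase_add (s t : ℝ) (z : ℂ) : phase (s + t) z = phase s z * phase t z := by
  rw [phase, phase, phase, ← Complex.exp_add]
  push_cast; ring_nf

theorem phase_zero (z : ℂ) : phase 0 z = 1 := by simp [phase]

/-- For `t ≠ 0` the phase has no limit at `r = 0`, which lies in the spectrum of `R` when `A` is
unbounded. The factor `r` restores continuity; this is why `R e^{itA}` is built before `e^{itA}`. -/
theorem continuousOn_mul_phase (t : ℝ) :
    ContinuousOn (fun r : ℝ => (r : ℂ) * phase t r) (Set.Icc 0 1) := by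
  intro r hr
  rcases hr.1.eq_or_lt with rfl | h
  · refine ContinuousAt.continuousWithinAt ?_
    rw [ContinuousAt, Complex.ofReal_zero, zero_mul]
    refine squeeze_zero_norm (a := fun r : ℝ => |r|) (fun r => ?_) ?_
    · rw [norm_mul, norm_phase, mul_one, Complex.norm_real, Real.norm_eq_abs]
    · exact (continuous_abs.tendsto' 0 0 abs_zero)
  · refine ContinuousAt.continuousWithinAt ?_
    unfold phase
    simp only [Complex.ofReal_re]
    have : ContinuousAt (fun r : ℝ => r⁻¹) r := continuousAt_inv₀ h.ne'
    fun_prop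

/-- `R e^{itA}`, where `R = (A + 1)⁻¹`. -/
def dampedGroup (R : H →L[ℂ] H) (t : ℝ) : H →L[ℂ] H := cfc (fun z => z * phase t z) R

/-- `e^{itA}`, where `R = (A + 1)⁻¹`. -/
def resolventGroup (R : H →L[ℂ] H) (t : ℝ) : H →L[ℂ] H :=
  (dampedGroup R t).toLinearMap.extendOfNorm R.toLinearMap

/-- The damping compensates the unbounded frequency: `r |s - t| (1/r - 1) = |s - t| (1 - r)`. -/
theorem abs_mul_phase_sub_le (s t : ℝ) {r : ℝ} (hr : r ∈ Set.Icc (0 : ℝ) 1) :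
    ‖(r : ℂ) * phase s r - r * phase t r‖ ≤ |s - t| := by
  have e : (r : ℂ) * phase s r - r * phase t r = r * phase t r * (phase (s - t) r - 1) := by
    have := phase_add (s - t) t r
    rw [sub_add_cancel] at this
    rw [this]; ring
  rw [e, norm_mul, norm_mul, norm_phase, mul_one, Complex.norm_real, Real.norm_eq_abs,
    abs_of_nonneg hr.1]
  have h := Real.norm_exp_I_mul_ofReal_sub_one_le (x := (s - t) * (r⁻¹ - 1))
  rw [Real.norm_eq_abs, abs_mul] at h
  rcases hr.1.eq_or_lt with rfl | h0
  · simp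
  have h2 : |r⁻¹ - 1| = r⁻¹ - 1 := abs_of_nonneg (by
    have := (one_le_inv₀ h0).2 hr.2
    linarith)
  calc r * ‖phase (s - t) r - 1‖ ≤ r * (|s - t| * (r⁻¹ - 1)) := by
        rw [h2] at h
        exact mul_le_mul_of_nonneg_left (by simpa [phase] using h) hr.1
    _ = |s - t| * (1 - r) := by field_simp
    _ ≤ |s - t| := mul_le_of_le_one_right (abs_nonneg _) (by linarith)

theorem norm_dampedGroup_sub_le {R : H →L[ℂ] H} (h0 : 0 ≤ R) (h1 : R ≤ 1) (s t : ℝ) :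
    ‖dampedGroup R s - dampedGroup R t‖ ≤ |s - t| :=
  norm_cfc_sub_le h0 h1 (continuousOn_mul_phase s) (continuousOn_mul_phase t) (abs_nonneg _)
    fun _ hr => abs_mul_phase_sub_le s t hr

theorem dampedGroup_zero {R : H →L[ℂ] H} (h0 : 0 ≤ R) : dampedGroup R 0 = R := by
  have hR : IsSelfAdjoint R := .of_nonneg h0
  simp only [dampedGroup, phase_zero, mul_one]
  exact cfc_id' ℂ R hR.isStarNormal

theorem commute_dampedGroup {R : H →L[ℂ] H} (h0 : 0 ≤ R) (t : ℝ) :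
    R * dampedGroup R t = dampedGroup R t * R := by
  have : Commute (dampedGroup R 0) (dampedGroup R t) := cfc_commute_cfc _ _ R
  rwa [dampedGroup_zero h0] at this

theorem dampedGroup_mul {R : H →L[ℂ] H} (h0 : 0 ≤ R) (h1 : R ≤ 1) (s t : ℝ) :
    dampedGroup R s * dampedGroup R t = R * dampedGroup R (s + t) := by
  have c : ∀ t, ContinuousOn (fun z : ℂ => z * phase t z) (spectrum ℂ R) := fun t =>
    continuousOn_spectrum h0 h1 (continuousOn_mul_phase t)
  conv_rhs => rw [← dampedGroup_zero h0, dampedGroup_zero h0]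
  have e : R = cfc (fun z => z * phase 0 z) R := (dampedGroup_zero h0).symm
  -- Only the outer factor `R` is written as a function of `R`, so that both sides become products
  -- of two functional calculi.
  conv_rhs => arg 1; rw [e]
  rw [dampedGroup, dampedGroup, dampedGroup, ← cfc_mul _ _ R (c s) (c t),
    ← cfc_mul _ _ R (c 0) (c _)]
  refine cfc_congr fun z _ => ?_
  simp only [phase_add, phase_zero]
  ring

/-- The adjoint of the damped group at `t` is the one at `-t`, so `T* T = R²` and `‖T u‖ = ‖R u‖`.
This is what makes the extension from the range of `R` well defined and isometric. -/
theorem norm_dampedGroup_apply {R : H →L[ℂ] H} (h0 : 0 ≤ R) (h1 : R ≤ 1) (t : ℝ) (u : H) :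
    ‖dampedGroup R t u‖ = ‖R u‖ := by
  have hR : IsSelfAdjoint R := .of_nonneg h0
  have hst : star (dampedGroup R t) = dampedGroup R (-t) := by
    rw [dampedGroup, ← cfc_star]
    refine cfc_congr fun z hz => ?_
    obtain ⟨r, hr, rfl⟩ := spectrum_subset_unitInterval h0 h1 hz
    simp [phase, ← Complex.exp_conj]
  have e : star (dampedGroup R t) * dampedGroup R t = star R * R := by
    rw [hst, dampedGroup_mul h0 h1, neg_add_cancel, dampedGroup_zero h0, hR.star_eq]
  have key : ∀ T : H →L[ℂ] H, ((‖T u‖ ^ 2 : ℝ) : ℂ) = inner ℂ u ((star T * T) u) := by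
    intro T
    rw [mul_apply_eq_comp, ContinuousLinearMap.star_eq_adjoint,
      ContinuousLinearMap.adjoint_inner_right, inner_self_eq_norm_sq_to_K]
    norm_cast
  have h3 := key (dampedGroup R t)
  rw [e, ← key R] at h3
  have h4 : ‖dampedGroup R t u‖ ^ 2 = ‖R u‖ ^ 2 := by exact_mod_cast h3
  exact (sq_eq_sq₀ (norm_nonneg _) (norm_nonneg _)).1 h4

end Group

/-- The usual three-term argument. The filter is general, and the bound only eventual, so that it
also covers difference quotients along a punctured neighbourhood. -/
theorem tendsto_apply_of_denseRange {α X E F : Type*} [NormedAddCommGroup E] [NormedSpace ℂ E]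
    [NormedAddCommGroup F] [NormedSpace ℂ F] {l : Filter α} {T : α → E →L[ℂ] F} {T₀ : E →L[ℂ] F}
    {C : ℝ} (hT : ∀ᶠ a in l, ‖T a‖ ≤ C) {e : X → E} (he : DenseRange e)
    (h : ∀ x, Tendsto (fun a => T a (e x)) l (𝓝 (T₀ (e x)))) (u : E) :
    Tendsto (fun a => T a u) l (𝓝 (T₀ u)) := by
  rw [Metric.tendsto_nhds]
  intro ε hε
  -- A common bound for the operators and their limit; the `+ 1` keeps it positive.
  set K := max C ‖T₀‖ + 1
  have hK : 0 < K := by have := le_max_right C ‖T₀‖; have := norm_nonneg T₀; simp only [K]; linarith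
  obtain ⟨x, hx⟩ := he.exists_dist_lt u (ε := ε / (4 * K)) (by positivity)
  filter_upwards [Metric.tendsto_nhds.1 (h x) (ε / 4) (by positivity), hT] with a ha hCa
  have near : ∀ S : E →L[ℂ] F, ‖S‖ ≤ K → ‖S (u - e x)‖ ≤ ε / 4 := fun S hS => by
    rw [dist_eq_norm] at hx
    calc ‖S (u - e x)‖ ≤ K * ‖u - e x‖ := S.le_of_opNorm_le hS _
      _ ≤ K * (ε / (4 * K)) := by gcongr
      _ = ε / 4 := by field_simp
  have a1 := near (T a) (by have := le_max_left C ‖T₀‖; simp only [K]; linarith)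
  have a2 := near T₀ (by have := le_max_right C ‖T₀‖; simp only [K]; linarith)
  rw [dist_eq_norm] at ha ⊢
  have : T a u - T₀ u = T a (u - e x) + (T a (e x) - T₀ (e x)) - T₀ (u - e x) := by
    simp only [map_sub]; abel
  rw [this]
  refine (norm_sub_le _ _).trans_lt ((add_le_add_left (norm_add_le _ _) _).trans_lt ?_)
  linarith

/-! ### The unitary group of a resolvent: group law, Trotter-Kato, generator, self-adjointness -/

section Group

variable {H : Type*} [NormedAddCommGroup H] [InnerProductSpace ℂ H] [CompleteSpace H]
  {R : H →L[ℂ] H}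

theorem resolventGroup_apply (h0 : 0 ≤ R) (h1 : R ≤ 1) (hd : DenseRange R) (t : ℝ) (u : H) :
    resolventGroup R t (R u) = dampedGroup R t u :=
  LinearMap.extendOfNorm_eq (f := (dampedGroup R t).toLinearMap) (e := R.toLinearMap) hd
    ⟨1, fun x => by simpa using (norm_dampedGroup_apply h0 h1 t x).le⟩ u

theorem norm_resolventGroup_apply (h0 : 0 ≤ R) (h1 : R ≤ 1) (hd : DenseRange R) (t : ℝ) (u : H) :
    ‖resolventGroup R t u‖ = ‖u‖ := by
  refine hd.induction_on (p := fun u => ‖resolventGroup R t u‖ = ‖u‖) u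
    (isClosed_eq (by fun_prop) (by fun_prop)) fun v => ?_
  rw [resolventGroup_apply h0 h1 hd, norm_dampedGroup_apply h0 h1]

theorem norm_resolventGroup_le (h0 : 0 ≤ R) (h1 : R ≤ 1) (hd : DenseRange R) (t : ℝ) :
    ‖resolventGroup R t‖ ≤ 1 :=
  ContinuousLinearMap.opNorm_le_bound _ zero_le_one fun u => by
    rw [norm_resolventGroup_apply h0 h1 hd, one_mul]

theorem resolventGroup_comm (h0 : 0 ≤ R) (h1 : R ≤ 1) (hd : DenseRange R) (t : ℝ) (u : H) :
    R (resolventGroup R t u) = resolventGroup R t (R u) := by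
  refine hd.induction_on (p := fun u => R (resolventGroup R t u) = resolventGroup R t (R u)) u
    (isClosed_eq (by fun_prop) (by fun_prop)) fun v => ?_
  rw [resolventGroup_apply h0 h1 hd, resolventGroup_apply h0 h1 hd]
  exact congrArg (fun T => T v) (commute_dampedGroup h0 t)

theorem resolventGroup_zero (h0 : 0 ≤ R) (h1 : R ≤ 1) (hd : DenseRange R) :
    resolventGroup R 0 = ContinuousLinearMap.id ℂ H := by
  refine ContinuousLinearMap.ext fun u => ?_
  refine hd.induction_on (p := fun u => resolventGroup R 0 u = u) u
    (isClosed_eq (by fun_prop) (by fun_prop)) fun v => ?_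
  rw [resolventGroup_apply h0 h1 hd, dampedGroup_zero h0]

theorem resolventGroup_add (h0 : 0 ≤ R) (h1 : R ≤ 1) (hd : DenseRange R) (s t : ℝ) :
    resolventGroup R (s + t) = (resolventGroup R s).comp (resolventGroup R t) := by
  refine ContinuousLinearMap.ext fun u => ?_
  -- Each of the two composed groups uses up one factor `R`, so the identity is checked on vectors
  -- `R (R v)`.
  refine (hd.comp hd R.continuous).induction_on
    (p := fun u => resolventGroup R (s + t) u = (resolventGroup R s) (resolventGroup R t u)) u
    (isClosed_eq (by fun_prop) (by fun_prop)) fun v => ?_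
  have c : ∀ t u, R (dampedGroup R t u) = dampedGroup R t (R u) := fun t u =>
    congrArg (fun T => T u) (commute_dampedGroup h0 t)
  rw [Function.comp_apply, resolventGroup_apply h0 h1 hd, resolventGroup_apply h0 h1 hd, ← c, ← c,
    resolventGroup_apply h0 h1 hd]
  exact (congrArg (fun T => T v) (dampedGroup_mul h0 h1 s t)).symm

/-- Trotter-Kato: strong convergence of the resolvents implies that of the groups. -/
theorem tendsto_resolventGroup {Rn : ℕ → H →L[ℂ] H} (hn0 : ∀ n, 0 ≤ Rn n) (hn1 : ∀ n, Rn n ≤ 1)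
    (hnd : ∀ n, DenseRange (Rn n)) (h0 : 0 ≤ R) (h1 : R ≤ 1) (hd : DenseRange R)
    (h : ∀ u, Tendsto (fun n => Rn n u) atTop (𝓝 (R u))) {t : ℕ → ℝ} {s : ℝ}
    (ht : Tendsto t atTop (𝓝 s)) (u : H) :
    Tendsto (fun n => resolventGroup (Rn n) (t n) u) atTop (𝓝 (resolventGroup R s u)) := by
  refine tendsto_apply_of_denseRange (C := 1)
    (.of_forall fun n => norm_resolventGroup_le (hn0 n) (hn1 n) (hnd n) _) hd (fun v => ?_) u
  rw [resolventGroup_apply h0 h1 hd]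
  -- Three errors: replacing `R v` by `Rn n v` (isometry), moving the time to `s` (Lipschitz bound
  -- uniform in `n`), and changing the operator at fixed time (strong convergence of continuous
  -- functions).
  have e : ∀ n, resolventGroup (Rn n) (t n) (R v) = resolventGroup (Rn n) (t n) (R v - Rn n v)
      + (dampedGroup (Rn n) (t n) - dampedGroup (Rn n) s) v + dampedGroup (Rn n) s v := fun n => by
    rw [map_sub, resolventGroup_apply (hn0 n) (hn1 n) (hnd n)]
    simp
  simp only [e]
  have l1 : Tendsto (fun n => resolventGroup (Rn n) (t n) (R v - Rn n v)) atTop (𝓝 0) := by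
    refine squeeze_zero_norm (a := fun n => ‖R v - Rn n v‖)
      (fun n => (norm_resolventGroup_apply (hn0 n) (hn1 n) (hnd n) _ _).le) ?_
    simpa using ((h v).const_sub (R v)).norm
  have l2 : Tendsto (fun n => (dampedGroup (Rn n) (t n) - dampedGroup (Rn n) s) v) atTop
      (𝓝 0) := by
    refine squeeze_zero_norm (a := fun n => |t n - s| * ‖v‖) (fun n =>
      ContinuousLinearMap.le_of_opNorm_le _ (norm_dampedGroup_sub_le (hn0 n) (hn1 n) _ _) v) ?_
    simpa using (ht.sub_const s).abs.mul_const ‖v‖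
  have l3 : Tendsto (fun n => dampedGroup (Rn n) s v) atTop (𝓝 (dampedGroup R s v)) :=
    tendsto_cfc_apply hn0 hn1 h0 h1 h (continuousOn_mul_phase s) v
  simpa only [zero_add] using (l1.add l2).add l3

/-- Taylor's estimate for `|x| ≤ 1`; for `|x| > 1` the trivial bound `2 |x|` is already below `2
x²`. -/
theorem norm_exp_sub_one_sub_le (x : ℝ) :
    ‖Complex.exp (Complex.I * x) - 1 - Complex.I * x‖ ≤ 2 * x ^ 2 := by
  have hn : ‖Complex.I * (x : ℂ)‖ = |x| := by simp
  rcases le_or_gt |x| 1 with h | h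
  · refine (Complex.norm_exp_sub_one_sub_id_le (hn.trans_le h)).trans ?_
    rw [hn, sq_abs]
    nlinarith [sq_nonneg x]
  · refine (norm_sub_le _ _).trans ?_
    have := Real.norm_exp_I_mul_ofReal_sub_one_le (x := x)
    rw [Real.norm_eq_abs] at this
    rw [hn, ← sq_abs]
    nlinarith

/-- The first-order expansion of `e^{ihA} R²`, with `A R² = R - R²`. The two factors of `r` absorb
the quadratic remainder: for `x = h (1/r - 1)`, `r² · 2 x² = 2 h² (1 - r)²`. -/
theorem norm_dampedGroup_mul_sub_le (h0 : 0 ≤ R) (h1 : R ≤ 1) (h : ℝ) :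
    ‖dampedGroup R h * R - R * R - (h * Complex.I) • (R - R * R)‖ ≤ 2 * h ^ 2 := by
  have hR : IsSelfAdjoint R := .of_nonneg h0
  have := hR.isStarNormal
  have c : ∀ t, ContinuousOn (fun z : ℂ => z * phase t z) (spectrum ℂ R) := fun t =>
    continuousOn_spectrum h0 h1 (continuousOn_mul_phase t)
  have e1 : cfc (fun z : ℂ => z * phase h z * z) R = dampedGroup R h * R := by
    rw [cfc_mul (fun z : ℂ => z * phase h z) (fun z => z) R (c h) (by fun_prop), cfc_id' ℂ R]
    rfl
  have e2 : cfc (fun z : ℂ => z * z) R = R * R := by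
    rw [cfc_mul (fun z : ℂ => z) (fun z => z) R (by fun_prop) (by fun_prop), cfc_id' ℂ R]
  have e3 : cfc (fun z : ℂ => z * z + (h * Complex.I) • (z - z * z)) R
      = R * R + (h * Complex.I) • (R - R * R) := by
    rw [cfc_add R (fun z : ℂ => z * z) (fun z : ℂ => (h * Complex.I) • (z - z * z)) (by fun_prop)
        (by fun_prop), cfc_smul (h * Complex.I) (fun z : ℂ => z - z * z) R (by fun_prop),
      cfc_sub (fun z : ℂ => z) (fun z : ℂ => z * z) R (by fun_prop) (by fun_prop), e2, cfc_id' ℂ R]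
  rw [sub_sub, ← e1, ← e3]
  refine norm_cfc_sub_le h0 h1 ((continuousOn_mul_phase h).mul (by fun_prop)) (by fun_prop)
    (by positivity) fun r hr => ?_
  rcases hr.1.eq_or_lt with rfl | hr0
  · simpa using sq_nonneg h
  have e4 : (r : ℂ) * phase h r * r - (r * r + (h * Complex.I) • (r - r * r))
      = r ^ 2 * (Complex.exp (Complex.I * (h * (r⁻¹ - 1) : ℝ)) - 1
        - Complex.I * (h * (r⁻¹ - 1) : ℝ)) := by
    have : (r : ℂ) ≠ 0 := by exact_mod_cast hr0.ne'
    simp only [phase, Complex.ofReal_re, smul_eq_mul]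
    push_cast
    field_simp
    ring
  rw [e4, norm_mul, norm_pow, Complex.norm_real, Real.norm_eq_abs, abs_of_pos hr0]
  calc r ^ 2 * _ ≤ r ^ 2 * (2 * (h * (r⁻¹ - 1)) ^ 2) := by
        gcongr; exact norm_exp_sub_one_sub_le _
    _ = 2 * h ^ 2 * (1 - r) ^ 2 := by field_simp
    _ ≤ 2 * h ^ 2 := mul_le_of_le_one_right (by positivity) (by nlinarith [hr.1, hr.2])

/-- The difference quotients have operator norm at most `1` by the Lipschitz bound, so it is enough
to differentiate on the range of `R`, where the quadratic remainder estimate applies. The limit is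
`i A R = i (1 - R)`. -/
theorem hasDerivAt_dampedGroup (h0 : 0 ≤ R) (h1 : R ≤ 1) (hd : DenseRange R) (g : H) :
    HasDerivAt (fun t => dampedGroup R t g) (Complex.I • (g - R g)) 0 := by
  rw [hasDerivAt_iff_tendsto_slope_zero]
  simp only [zero_add, dampedGroup_zero h0]
  have key := tendsto_apply_of_denseRange (l := 𝓝[≠] (0 : ℝ))
    (T := fun t => ((t⁻¹ : ℝ) : ℂ) • (dampedGroup R t - R)) (T₀ := Complex.I • (1 - R)) (C := 1)
    (eventually_mem_nhdsWithin.mono fun t ht => ?_) hd (fun v => ?_) g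
  · simpa [← Complex.ofReal_inv, Complex.coe_smul] using key
  · have := norm_dampedGroup_sub_le h0 h1 t 0
    rw [dampedGroup_zero h0, sub_zero] at this
    rw [norm_smul, Complex.norm_real, norm_inv, Real.norm_eq_abs]
    exact inv_mul_le_one_of_le₀ this (abs_nonneg t)
  · rw [tendsto_iff_norm_sub_tendsto_zero]
    have hl : Tendsto (fun t : ℝ => 2 * |t| * ‖v‖) (𝓝[≠] 0) (𝓝 0) := by
      have : Tendsto (fun t : ℝ => 2 * |t| * ‖v‖) (𝓝 0) (𝓝 0) :=
        Continuous.tendsto' (by fun_prop) _ _ (by simp)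
      exact this.mono_left nhdsWithin_le_nhds
    refine squeeze_zero' (.of_forall fun _ => norm_nonneg _)
      (eventually_mem_nhdsWithin.mono fun t ht => ?_) hl
    have ht' : (t : ℂ) ≠ 0 := by exact_mod_cast ht
    have e : (((t⁻¹ : ℝ) : ℂ) • (dampedGroup R t - R)) (R v) - (Complex.I • (1 - R)) (R v)
        = ((t⁻¹ : ℝ) : ℂ) •
          (dampedGroup R t * R - R * R - (t * Complex.I) • (R - R * R)) v := by
      simp only [smul_apply, sub_apply, mul_apply_eq_comp, smul_sub, smul_smul, one_apply_eq_self]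
      rw [Complex.ofReal_inv, inv_mul_cancel_left₀ ht']
    rw [e, norm_smul, Complex.norm_real, norm_inv, Real.norm_eq_abs]
    have ht'' : 0 < |t| := abs_pos.2 ht
    calc _ ≤ |t|⁻¹ * (2 * t ^ 2 * ‖v‖) := by
          gcongr
          exact ContinuousLinearMap.le_of_opNorm_le _ (norm_dampedGroup_mul_sub_le h0 h1 t) v
      _ = 2 * |t| * ‖v‖ := by rw [← sq_abs]; field_simp

variable {A : H →ₗ.[ℂ] H}

/-- The condition `u = R (f + u)` expresses `A = R⁻¹ - 1` without inverting `R`. -/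
theorem isUnitaryGroupOf_resolventGroup (h0 : 0 ≤ R) (h1 : R ≤ 1) (hd : DenseRange R)
    (hA : ∀ u f, (u, f) ∈ A.graph ↔ u = R (f + u)) :
    IsUnitaryGroupOf A (resolventGroup R) where
  zero := resolventGroup_zero h0 h1 hd
  add := resolventGroup_add h0 h1 hd
  norm := norm_resolventGroup_apply h0 h1 hd
  continuous u := continuous_iff_continuousAt.2 fun s => by
    refine tendsto_apply_of_denseRange (C := 1)
      (.of_forall fun t => norm_resolventGroup_le h0 h1 hd t) hd (fun v => ?_) u
    simp only [resolventGroup_apply h0 h1 hd]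
    rw [tendsto_iff_norm_sub_tendsto_zero]
    have hl : Tendsto (fun t : ℝ => |t - s| * ‖v‖) (𝓝 s) (𝓝 0) :=
      Continuous.tendsto' (by fun_prop) _ _ (by simp)
    exact squeeze_zero (fun _ => norm_nonneg _) (fun t => ContinuousLinearMap.le_of_opNorm_le
      (dampedGroup R t - dampedGroup R s) (norm_dampedGroup_sub_le h0 h1 _ _) v) hl
  generator u f := by
    have fwd : ∀ g, HasDerivAt (fun t => resolventGroup R t (R g)) (Complex.I • (g - R g)) 0 := by
      intro g
      simpa only [resolventGroup_apply h0 h1 hd] using hasDerivAt_dampedGroup h0 h1 hd g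
    rw [hA]
    constructor
    · intro h
      have := fwd (f + u)
      rwa [← h, add_sub_cancel_right] at this
    · intro h
      have hR : IsSelfAdjoint R := .of_nonneg h0
      have hsym : ∀ x y, inner ℂ (R x) y = inner ℂ x (R y) := fun x y =>
        hR.isSymmetric x y
      have adj : ∀ t x y, inner ℂ x (resolventGroup R t y) = inner ℂ (resolventGroup R (-t) x) y := by
        intro t x y
        have h2 := (LinearMap.norm_map_iff_inner_map_map (resolventGroup R (-t))).1
          (norm_resolventGroup_apply h0 h1 hd (-t)) x (resolventGroup R t y)
        rw [← h2]
        congr 1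
        have := congrArg (fun T => T y) (resolventGroup_add h0 h1 hd (-t) t)
        simpa [resolventGroup_zero h0 h1 hd] using this.symm
      -- The function `⟨R g, e^{itA} u⟩ = ⟨e^{-itA} R g, u⟩` is differentiated at `0` in both forms,
      -- the second being legitimate because `R g` is in the domain. Comparison gives `⟨R g, f⟩ = ⟨g
      -- - R g, u⟩`.
      have key : ∀ g, inner ℂ g (R (f + u)) = inner ℂ g u := by
        intro g
        have d1 := (hasDerivAt_const (0 : ℝ) (R g)).inner ℂ h
        have d2 : HasDerivAt (fun t => resolventGroup R (-t) (R g))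
            (-(Complex.I • (g - R g))) 0 := by
          have := (fwd g)
          rw [← neg_zero] at this
          simpa [Function.comp_def] using this.scomp (0 : ℝ) (hasDerivAt_neg 0)
        have d3 := d2.inner ℂ (hasDerivAt_const (0 : ℝ) u)
        simp only [← adj] at d3
        have h4 := d1.unique d3
        simp only [inner_zero_left, inner_zero_right, zero_add, add_zero,
          resolventGroup_zero h0 h1 hd, ContinuousLinearMap.id_apply, inner_neg_left,
          inner_smul_left, inner_smul_right, Complex.conj_I, neg_mul, neg_neg,
          inner_sub_left] at h4
        have h5 := mul_left_cancel₀ Complex.I_ne_zero h4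
        rw [← hsym, inner_add_right, h5]
        ring
      exact (ext_inner_left ℂ fun g => key g).symm

theorem apply_mem_graph (hA : ∀ u f, (u, f) ∈ A.graph ↔ u = R (f + u)) (g : H) :
    (R g, g - R g) ∈ A.graph := (hA _ _).2 (by rw [sub_add_cancel])

theorem dense_domain_of_resolvent (hd : DenseRange R)
    (hA : ∀ u f, (u, f) ∈ A.graph ↔ u = R (f + u)) : Dense (A.domain : Set H) := by
  refine hd.mono ?_
  rintro _ ⟨g, rfl⟩
  exact LinearPMap.mem_domain_of_mem_graph (apply_mem_graph hA g)

/-- Symmetry of `A` is symmetry of `R`. If `A* y = z`, testing against `R g`, for which `A R g = g -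
R g`, yields `⟨z, R g⟩ = ⟨y, g - R g⟩` for all `g`, hence `y = R (z + y)`: there is no room for a
proper extension. -/
theorem isSelfAdjoint_of_resolvent (h0 : 0 ≤ R) (hd : DenseRange R)
    (hA : ∀ u f, (u, f) ∈ A.graph ↔ u = R (f + u)) : IsSelfAdjoint A := by
  have hR : IsSelfAdjoint R := .of_nonneg h0
  have hsym : ∀ x y, inner ℂ (R x) y = inner ℂ x (R y) := fun x y => hR.isSymmetric x y
  have hdom := dense_domain_of_resolvent hd hA
  have hs : A.IsFormalAdjoint A := by
    intro x y
    have hx := (hA _ _).1 (A.mem_graph x)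
    have hy := (hA _ _).1 (A.mem_graph y)
    have h1 : inner ℂ (A x + x) (y : H) = inner ℂ (x : H) (A y + y) := by
      conv_lhs => rw [hy, ← hsym, ← hx]
    rw [inner_add_left, inner_add_right] at h1
    exact add_right_cancel h1
  rw [LinearPMap.isSelfAdjoint_def]
  refine le_antisymm ?_ (hs.le_adjoint hdom)
  refine LinearPMap.le_of_le_graph ?_
  rintro ⟨y, z⟩ hp
  obtain ⟨yy, hy1, hy2⟩ := (LinearPMap.mem_graph_iff _).1 hp
  refine (hA _ _).2 ?_
  simp only at hy1 hy2
  refine ext_inner_right ℂ fun g => ?_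
  obtain ⟨xx, hx1, hx2⟩ := (LinearPMap.mem_graph_iff _).1 (apply_mem_graph hA g)
  simp only at hx1 hx2
  have h1 := A.adjoint_isFormalAdjoint hdom yy xx
  rw [hy1, hy2, hx1, hx2, inner_sub_right] at h1
  rw [hsym, inner_add_left, h1]
  ring

end Group

/-! ### Operators defined by quadratic forms -/

section Form

variable {H E K : Type*} [NormedAddCommGroup H] [InnerProductSpace ℂ H] [CompleteSpace H]
  [NormedAddCommGroup E] [InnerProductSpace ℂ E] [CompleteSpace E]
  [NormedAddCommGroup K] [InnerProductSpace ℂ K] [CompleteSpace K]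

/-- Conjugation by a unitary is a continuous star-algebra isomorphism and so commutes with the
functional calculus; density of the range carries this from the damped groups to the groups. -/
theorem resolventGroup_conj {R S : H →L[ℂ] H} (e : H ≃ₗᵢ[ℂ] H) (h0 : 0 ≤ R) (h1 : R ≤ 1)
    (hd : DenseRange R) (hS0 : 0 ≤ S) (hS1 : S ≤ 1) (hSd : DenseRange S)
    (h : ∀ u, S u = e.symm (R (e u))) (t : ℝ) (u : H) :
    resolventGroup S t u = e.symm (resolventGroup R t (e u)) := by
  have hR : IsSelfAdjoint R := .of_nonneg h0
  have hS : IsSelfAdjoint S := .of_nonneg hS0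
  have hRS : e.symm.conjStarAlgEquiv R = S := ContinuousLinearMap.ext fun u => (h u).symm
  have hφ : Continuous (e.symm.conjStarAlgEquiv : (H →L[ℂ] H) ≃⋆ₐ[ℂ] (H →L[ℂ] H)) :=
    map_continuous e.symm.conjStarAlgEquiv
  have hdg : e.symm.conjStarAlgEquiv (dampedGroup R t) = dampedGroup S t := by
    have := StarAlgHomClass.map_cfc (R := ℂ) (S := ℂ) e.symm.conjStarAlgEquiv
      (fun z => z * phase t z) R (continuousOn_spectrum h0 h1 (continuousOn_mul_phase t)) hφ
      hR.isStarNormal (by rw [hRS]; exact hS.isStarNormal)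
    rw [hRS] at this
    exact this
  refine hSd.induction_on
    (p := fun u => resolventGroup S t u = e.symm (resolventGroup R t (e u))) u
    (isClosed_eq (by fun_prop) (by fun_prop)) fun v => ?_
  rw [resolventGroup_apply hS0 hS1 hSd, ← hdg, h v, LinearIsometryEquiv.apply_symm_apply,
    resolventGroup_apply h0 h1 hd]
  rfl

theorem denseRange_of_orthogonal {T : K →L[ℂ] E}
    (h : ∀ v, (∀ x, inner ℂ (T x) v = 0) → v = 0) : DenseRange T := by
  have : T.range.topologicalClosure = ⊤ := by
    rw [Submodule.topologicalClosure_eq_top_iff, Submodule.eq_bot_iff]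
    intro v hv
    exact h v fun x => hv (T x) ⟨x, rfl⟩
  have h2 := Submodule.dense_iff_topologicalClosure_eq_top.2 this
  exact h2

/-- The operator on the form domain associated with `(v, w) ↦ (v, w) + (M v, M w)`. -/
def formOp (M : E →L[ℂ] K) : E →L[ℂ] E := 1 + M.adjoint ∘L M

/-- The inverse of `formOp M`. -/
def formInv (M : E →L[ℂ] K) : E →L[ℂ] E := Ring.inverse (formOp M)

theorem inner_formOp_right (M : E →L[ℂ] K) (v w : E) :
    inner ℂ v (formOp M w) = inner ℂ v w + inner ℂ (M v) (M w) := by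
  simp [formOp, ContinuousLinearMap.adjoint_inner_right]

theorem inner_formOp_left (M : E →L[ℂ] K) (v w : E) :
    inner ℂ (formOp M v) w = inner ℂ v w + inner ℂ (M v) (M w) := by
  simp [formOp, ContinuousLinearMap.adjoint_inner_left]

theorem re_inner_formOp_self (M : E →L[ℂ] K) (v : E) :
    (inner ℂ v (formOp M v)).re = ‖v‖ ^ 2 + ‖M v‖ ^ 2 := by
  rw [inner_formOp_right, inner_self_eq_norm_sq_to_K, inner_self_eq_norm_sq_to_K]
  norm_cast

/-- Lax-Milgram: `Re ⟨v, (1 + M*M) v⟩ ≥ ‖v‖²`. -/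
theorem isUnit_formOp (M : E →L[ℂ] K) : IsUnit (formOp M) := by
  refine ContinuousLinearMap.isUnit_of_forall_le_norm_inner_map _ (c := 1) one_pos fun x => ?_
  rw [NNReal.coe_one, mul_one, norm_inner_symm]
  refine le_trans ?_ (Complex.re_le_norm _)
  rw [re_inner_formOp_self]
  linarith [sq_nonneg ‖M x‖]

theorem formOp_formInv (M : E →L[ℂ] K) (v : E) : formOp M (formInv M v) = v :=
  congrArg (fun T => T v) (Ring.mul_inverse_cancel _ (isUnit_formOp M))

theorem formInv_formOp (M : E →L[ℂ] K) (v : E) : formInv M (formOp M v) = v :=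
  congrArg (fun T => T v) (Ring.inverse_mul_cancel _ (isUnit_formOp M))

theorem norm_formInv_apply_le (M : E →L[ℂ] K) (v : E) : ‖formInv M v‖ ≤ ‖v‖ := by
  have h := re_inner_formOp_self M (formInv M v)
  rw [formOp_formInv] at h
  have h2 := (Complex.re_le_norm _).trans (norm_inner_le_norm (𝕜 := ℂ) (formInv M v) v)
  have h3 : ‖formInv M v‖ * ‖formInv M v‖ ≤ ‖formInv M v‖ * ‖v‖ := by
    nlinarith [sq_nonneg ‖M (formInv M v)‖]
  rcases (norm_nonneg (formInv M v)).eq_or_lt with h4 | h4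
  · rw [← h4]; exact norm_nonneg v
  · exact le_of_mul_le_mul_left h3 h4

/-- The solution operator `f ↦ w` of `(v, w) + (M v, M w) = (J v, f)`. -/
def formSolve (J : E →L[ℂ] H) (M : E →L[ℂ] K) : H →L[ℂ] E := formInv M ∘L J.adjoint

/-- The resolvent of the operator associated with the form `(v, w) ↦ (v, w) + (M v, M w)`. -/
def formResolvent (J : E →L[ℂ] H) (M : E →L[ℂ] K) : H →L[ℂ] H := J ∘L formSolve J M

variable {J : E →L[ℂ] H} {M : E →L[ℂ] K}

theorem formResolvent_apply (f : H) : formResolvent J M f = J (formSolve J M f) := rfl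

theorem inner_formSolve (v : E) (f : H) :
    inner ℂ v (formSolve J M f) + inner ℂ (M v) (M (formSolve J M f)) = inner ℂ (J v) f := by
  rw [← inner_formOp_right, formSolve, ContinuousLinearMap.comp_apply, formOp_formInv,
    ContinuousLinearMap.adjoint_inner_right]

theorem eq_formSolve {w : E} {f : H}
    (h : ∀ v, inner ℂ v w + inner ℂ (M v) (M w) = inner ℂ (J v) f) : w = formSolve J M f := by
  have : formOp M w = J.adjoint f := ext_inner_left ℂ fun v => by
    rw [inner_formOp_right, h, ContinuousLinearMap.adjoint_inner_right]
  rw [formSolve, ContinuousLinearMap.comp_apply, ← this, formInv_formOp]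

/-- `⟨R f, g⟩` is the form evaluated at the two weak solutions, and the form is Hermitian and
nonnegative. -/
theorem isPositive_formResolvent : (formResolvent J M).IsPositive := by
  have key : ∀ f g, inner ℂ (formResolvent J M f) g
      = inner ℂ (formSolve J M f) (formSolve J M g)
        + inner ℂ (M (formSolve J M f)) (M (formSolve J M g)) := fun f g => by
    rw [inner_formSolve, formResolvent_apply]
  refine ⟨fun f g => ?_, fun f => ?_⟩
  · have h1 := key f g
    have h2 := congrArg (starRingEnd ℂ) (key g f)
    rw [map_add, inner_conj_symm, inner_conj_symm, inner_conj_symm, ← h1] at h2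
    exact h2.symm
  · rw [ContinuousLinearMap.reApplyInnerSelf_apply, key, map_add]
    exact add_nonneg inner_self_nonneg inner_self_nonneg

theorem formResolvent_nonneg : 0 ≤ formResolvent J M :=
  (ContinuousLinearMap.nonneg_iff_isPositive _).2 isPositive_formResolvent

theorem formResolvent_le_one (hJ : ‖J‖ ≤ 1) : formResolvent J M ≤ 1 := by
  have hn : 0 ≤ formResolvent J M := formResolvent_nonneg
  refine (CStarAlgebra.norm_le_one_iff_of_nonneg _ hn).1 ?_
  refine ContinuousLinearMap.opNorm_le_bound _ zero_le_one fun f => ?_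
  have h1 : ‖J.adjoint‖ ≤ 1 := (ContinuousLinearMap.adjoint.norm_map J).trans_le hJ
  calc ‖formResolvent J M f‖ ≤ 1 * ‖formSolve J M f‖ := J.le_of_opNorm_le hJ _
    _ ≤ 1 * ‖J.adjoint f‖ := by gcongr; exact norm_formInv_apply_le _ _
    _ ≤ 1 * (1 * ‖f‖) := by gcongr; exact ContinuousLinearMap.le_of_opNorm_le _ h1 _
    _ = 1 * ‖f‖ := one_mul _

theorem denseRange_adjoint (hinj : Function.Injective J) : DenseRange J.adjoint := by
  refine denseRange_of_orthogonal fun v hv => hinj ?_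
  rw [map_zero]
  refine ext_inner_left ℂ fun x => ?_
  rw [inner_zero_right, ← hv x, ContinuousLinearMap.adjoint_inner_left]

/-- Injectivity of `J` makes the range of `J*` dense, and `formInv M` is onto. -/
theorem denseRange_formSolve (hinj : Function.Injective J) : DenseRange (formSolve J M) := by
  have hs : Function.Surjective (formInv M) := fun v => ⟨_, formInv_formOp M v⟩
  exact hs.denseRange.comp (denseRange_adjoint hinj) (formInv M).continuous

theorem denseRange_formResolvent (hinj : Function.Injective J) (hJd : DenseRange J) :
    DenseRange (formResolvent J M) :=
  hJd.comp (denseRange_formSolve hinj) J.continuous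

/-- The group preserves the form domain and the form. -/
theorem exists_resolventGroup_lift (hJ : ‖J‖ ≤ 1) (hinj : Function.Injective J)
    (hJd : DenseRange J) (t : ℝ) (w : E) : ∃ w' : E,
      J w' = resolventGroup (formResolvent J M) t (J w) ∧
      ‖w'‖ ^ 2 + ‖M w'‖ ^ 2 = ‖w‖ ^ 2 + ‖M w‖ ^ 2 := by
  have h0 : 0 ≤ formResolvent J M := formResolvent_nonneg
  have h1 : formResolvent J M ≤ 1 := formResolvent_le_one hJ
  have hd := denseRange_formResolvent (M := M) hinj hJd
  set U := resolventGroup (formResolvent J M) t with hU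
  set G := formSolve J M with hG
  have hGd : DenseRange G := denseRange_formSolve hinj
  -- On the range of `G` the form is `⟨R f, f⟩`, which is conserved because `U` is an isometry
  -- commuting with `R`.
  have form : ∀ f, ‖G f‖ ^ 2 + ‖M (G f)‖ ^ 2 = (inner ℂ (formResolvent J M f) f).re := by
    intro f
    rw [formResolvent_apply, ← inner_formSolve (M := M), ← inner_formOp_right, re_inner_formOp_self]
  have inv : ∀ f, ‖G (U f)‖ ^ 2 + ‖M (G (U f))‖ ^ 2 = ‖G f‖ ^ 2 + ‖M (G f)‖ ^ 2 := by
    intro f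
    rw [form, form, resolventGroup_comm h0 h1 hd]
    congr 1
    exact (LinearMap.norm_map_iff_inner_map_map U).1 (norm_resolventGroup_apply h0 h1 hd t) _ _
  -- The conserved form is equivalent to the squared norm of `E`, so `G f ↦ G (U f)` is bounded and
  -- extends to all of `E`.
  have bd : ∃ C, ∀ f, ‖(G ∘L U).toLinearMap f‖ ≤ C * ‖G.toLinearMap f‖ := by
    refine ⟨Real.sqrt (1 + ‖M‖ ^ 2), fun f => ?_⟩
    change ‖G (U f)‖ ≤ _ * ‖G f‖
    have hM := pow_le_pow_left₀ (norm_nonneg _) (M.le_opNorm (G f)) 2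
    rw [mul_pow] at hM
    have := inv f
    rw [← Real.sqrt_sq (norm_nonneg (G f)), ← Real.sqrt_mul (by positivity)]
    exact Real.le_sqrt_of_sq_le (by nlinarith [sq_nonneg ‖M (G (U f))‖])
  set W := (G ∘L U).toLinearMap.extendOfNorm G.toLinearMap
  have hW : ∀ f, W (G f) = G (U f) := fun f => LinearMap.extendOfNorm_eq
    (f := (G ∘L U).toLinearMap) (e := G.toLinearMap) hGd bd f
  refine ⟨W w, ?_, ?_⟩
  · refine hGd.induction_on (p := fun w => J (W w) = U (J w)) w
      (isClosed_eq (by fun_prop) (by fun_prop)) fun f => ?_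
    rw [hW]
    exact resolventGroup_comm h0 h1 hd t f
  · refine hGd.induction_on (p := fun w => ‖W w‖ ^ 2 + ‖M (W w)‖ ^ 2 = ‖w‖ ^ 2 + ‖M w‖ ^ 2) w
      (isClosed_eq (by fun_prop) (by fun_prop)) fun f => ?_
    rw [hW]
    exact inv f

/-- Convergence in `H` together with an asymptotic bound of the form by its value at the limit
implies convergence in the form domain. -/
theorem tendsto_of_form_le (hinj : Function.Injective J) {w : ℕ → E} {w₀ : E} {b : ℕ → ℝ}
    (hJw : Tendsto (fun n => J (w n)) atTop (𝓝 (J w₀)))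
    (hb : ∀ n, ‖w n‖ ^ 2 + ‖M (w n)‖ ^ 2 ≤ b n)
    (hlim : Tendsto b atTop (𝓝 (‖w₀‖ ^ 2 + ‖M w₀‖ ^ 2))) : Tendsto w atTop (𝓝 w₀) := by
  obtain ⟨B, hB⟩ := hlim.bddAbove_range
  have hbound : ∀ n, ‖innerSL ℂ (w n)‖ ≤ Real.sqrt B := fun n => by
    rw [innerSL_apply_norm]
    refine Real.le_sqrt_of_sq_le ?_
    have := hb n
    have := hB ⟨n, rfl⟩
    nlinarith [sq_nonneg ‖M (w n)‖]
  -- Weak convergence in `E`: the sequence is bounded, and pairings with the dense set of vectors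
  -- `J* f` are pairings in `H`.
  have weak : ∀ v, Tendsto (fun n => innerSL ℂ (w n) v) atTop (𝓝 (innerSL ℂ w₀ v)) := by
    refine tendsto_apply_of_denseRange (.of_forall hbound) (denseRange_adjoint hinj) fun f => ?_
    simp only [innerSL_apply_apply, ContinuousLinearMap.adjoint_inner_right]
    exact hJw.inner tendsto_const_nhds
  -- Expanding the form at `w n - w₀`, the cross term is the pairing of `w n` with the fixed vector
  -- `formOp M w₀`, to which weak convergence applies.
  have hq : ∀ n, ‖w n - w₀‖ ^ 2 + ‖M (w n - w₀)‖ ^ 2 = (‖w n‖ ^ 2 + ‖M (w n)‖ ^ 2)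
      + (‖w₀‖ ^ 2 + ‖M w₀‖ ^ 2) - 2 * (innerSL ℂ (w n) (formOp M w₀)).re := by
    intro n
    rw [innerSL_apply_apply, inner_formOp_right, map_sub, @norm_sub_sq ℂ, @norm_sub_sq ℂ,
      Complex.add_re]
    simp only [RCLike.re_eq_complex_re]
    ring
  have h2 : Tendsto (fun n => b n + (‖w₀‖ ^ 2 + ‖M w₀‖ ^ 2)
      - 2 * (innerSL ℂ (w n) (formOp M w₀)).re) atTop (𝓝 0) := by
    have h3 := (Complex.continuous_re.tendsto _).comp (weak (formOp M w₀))
    have h4 := (hlim.add_const (‖w₀‖ ^ 2 + ‖M w₀‖ ^ 2)).sub (h3.const_mul 2)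
    rw [innerSL_apply_apply, re_inner_formOp_self] at h4
    have e : ‖w₀‖ ^ 2 + ‖M w₀‖ ^ 2 + (‖w₀‖ ^ 2 + ‖M w₀‖ ^ 2) - 2 * (‖w₀‖ ^ 2 + ‖M w₀‖ ^ 2) = 0 := by
      ring
    rw [e] at h4
    exact h4
  rw [tendsto_iff_norm_sub_tendsto_zero]
  have h5 : Tendsto (fun n => ‖w n - w₀‖ ^ 2) atTop (𝓝 0) := by
    refine squeeze_zero (fun _ => sq_nonneg _) (fun n => ?_) h2
    have := hq n
    have := hb n
    nlinarith [sq_nonneg ‖M (w n - w₀)‖]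
  simpa using h5.sqrt

/-- If the perturbations `M n` tend strongly to zero, the resolvents converge strongly. -/
theorem tendsto_formResolvent {M : ℕ → E →L[ℂ] K} {C : ℝ} (hM : ∀ n, ‖M n‖ ≤ C)
    (h : ∀ v, Tendsto (fun n => M n v) atTop (𝓝 0)) (f : H) :
    Tendsto (fun n => formResolvent J (M n) f) atTop
      (𝓝 (formResolvent J (0 : E →L[ℂ] K) f)) := by
  have key : ∀ v, Tendsto (fun n => formInv (M n) v) atTop (𝓝 v) := by
    intro v
    rw [tendsto_iff_norm_sub_tendsto_zero]
    have hl : Tendsto (fun n => C * ‖M n v‖) atTop (𝓝 0) := by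
      simpa using (h v).norm.const_mul C
    refine squeeze_zero (fun _ => norm_nonneg _) (fun n => ?_) hl
    -- The resolvent identity against the identity operator: the difference is `-formInv (M n) ((M
    -- n)* (M n v))`, and `formInv` is a contraction.
    have e : formInv (M n) v - v = formInv (M n) (v - formOp (M n) v) := by
      rw [map_sub, formInv_formOp]
    rw [e]
    refine (norm_formInv_apply_le _ _).trans ?_
    have e2 : v - formOp (M n) v = -((M n).adjoint (M n v)) := by simp [formOp]
    rw [e2, norm_neg]
    exact ContinuousLinearMap.le_of_opNorm_le _
      ((ContinuousLinearMap.adjoint.norm_map (M n)).trans_le (hM n)) _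
  have e0 : formInv (0 : E →L[ℂ] K) (J.adjoint f) = J.adjoint f := by
    conv_rhs => rw [← formInv_formOp (0 : E →L[ℂ] K) (J.adjoint f)]
    simp [formOp]
  simp only [formResolvent, formSolve, ContinuousLinearMap.comp_apply, e0]
  exact (J.continuous.tendsto _).comp (key _)

/-- If the perturbations `M n` tend strongly to zero, the groups converge in the form domain. -/
theorem exists_tendsto_resolventGroup_lift (hJ : ‖J‖ ≤ 1) (hinj : Function.Injective J)
    (hJd : DenseRange J) {M : ℕ → E →L[ℂ] K} {C : ℝ} (hM : ∀ n, ‖M n‖ ≤ C)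
    (h : ∀ v, Tendsto (fun n => M n v) atTop (𝓝 0)) {t : ℕ → ℝ} {s : ℝ}
    (ht : Tendsto t atTop (𝓝 s)) (v : E) : ∃ (φ : E) (w : ℕ → E),
      (∀ n, J (w n) = resolventGroup (formResolvent J (M n)) (t n) (J v)) ∧
      Tendsto w atTop (𝓝 φ) := by
  choose w hw hwn using fun n => exists_resolventGroup_lift (M := M n) hJ hinj hJd (t n) v
  obtain ⟨φ, hφ, hφn⟩ := exists_resolventGroup_lift (M := (0 : E →L[ℂ] K)) hJ hinj hJd s v
  -- The limiting form has `M = 0`. The conserved value `‖v‖² + ‖M n v‖²` dominates `‖w n‖²` and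
  -- tends to `‖v‖² = ‖φ‖²`, so an inequality is enough.
  refine ⟨φ, w, hw, tendsto_of_form_le (M := (0 : E →L[ℂ] K)) hinj
    (b := fun n => ‖v‖ ^ 2 + ‖M n v‖ ^ 2) ?_ (fun n => ?_) ?_⟩
  · rw [hφ]
    simp only [hw]
    exact tendsto_resolventGroup (fun n => formResolvent_nonneg)
      (fun n => formResolvent_le_one hJ) (fun n => denseRange_formResolvent hinj hJd)
      formResolvent_nonneg (formResolvent_le_one hJ) (denseRange_formResolvent hinj hJd)
      (tendsto_formResolvent hM h) ht _
  · rw [← hwn]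
    simp
  · rw [hφn]
    simpa using ((h v).norm.pow 2).const_add (‖v‖ ^ 2)

/-- Joint strong continuity of the group on the form domain. -/
theorem exists_tendsto_resolventGroup_of_tendsto (hJ : ‖J‖ ≤ 1) (hinj : Function.Injective J)
    (hJd : DenseRange J) {t : ℕ → ℝ} {s : ℝ} (ht : Tendsto t atTop (𝓝 s)) {v : ℕ → E} {v₀ : E}
    (hv : Tendsto v atTop (𝓝 v₀)) : ∃ (φ : E) (w : ℕ → E),
      J φ = resolventGroup (formResolvent J M) s (J v₀) ∧
      (∀ n, J (w n) = resolventGroup (formResolvent J M) (t n) (J (v n))) ∧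
      Tendsto w atTop (𝓝 φ) := by
  have h0 : 0 ≤ formResolvent J M := formResolvent_nonneg
  have h1 : formResolvent J M ≤ 1 := formResolvent_le_one hJ
  have hd := denseRange_formResolvent (M := M) hinj hJd
  choose w hw hwn using fun n => exists_resolventGroup_lift (M := M) hJ hinj hJd (t n) (v n)
  obtain ⟨φ, hφ, hφn⟩ := exists_resolventGroup_lift (M := M) hJ hinj hJd s v₀
  refine ⟨φ, w, hφ, hw, tendsto_of_form_le (M := M) hinj ?_ (fun n => (hwn n).le) ?_⟩
  · rw [hφ]
    simp only [hw]
    have l1 := tendsto_resolventGroup (fun _ => h0) (fun _ => h1) (fun _ => hd) h0 h1 hd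
      (fun u => tendsto_const_nhds) ht (J v₀)
    have l2 : Tendsto (fun n => resolventGroup (formResolvent J M) (t n) (J (v n) - J v₀)) atTop
        (𝓝 0) := by
      refine squeeze_zero_norm (fun n => (norm_resolventGroup_apply h0 h1 hd _ _).le) ?_
      simpa using (((J.continuous.tendsto _).comp hv).sub_const (J v₀)).norm
    simpa using l2.add l1
  · rw [hφn]
    have : Continuous fun x : E => ‖x‖ ^ 2 + ‖M x‖ ^ 2 := by fun_prop
    exact (this.tendsto v₀).comp hv

end Form

/-! ### Basic structure of `H¹` -/

section Sobolev

variable {d : ℕ}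

theorem L2.eLpNorm_eq (u : L2 d) : eLpNorm u 2 volume = ENNReal.ofReal ‖u‖ := by
  rw [Lp.norm_def, ENNReal.ofReal_toReal (Lp.eLpNorm_ne_top u)]

/-- Continuous compactly supported functions lie in every `L^p`. -/
theorem memLp_of_compactSupport {F : Type*} [NormedAddCommGroup F] {f : Space d → F}
    (hc : Continuous f) (hs : HasCompactSupport f) (p : ℝ≥0∞) : MemLp f p volume :=
  hc.memLp_of_hasCompactSupport hs

theorem memLp_ofReal {φ : Space d → ℝ} (hc : Continuous φ) (hs : HasCompactSupport φ) :
    MemLp (fun x => (φ x : ℂ)) 2 volume :=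
  memLp_of_compactSupport (Complex.continuous_ofReal.comp hc)
    (hs.comp_left Complex.ofReal_zero) 2

/-- The functional `u ↦ ∫ φ u` on `L²`. -/
def testPairing (φ : Space d → ℝ) (hc : Continuous φ) (hs : HasCompactSupport φ) : L2 d →L[ℂ] ℂ :=
  innerSL ℂ (MemLp.toLp _ (memLp_ofReal hc hs))

theorem testPairing_apply (φ : Space d → ℝ) (hc : Continuous φ) (hs : HasCompactSupport φ)
    (u : L2 d) : testPairing φ hc hs u = ∫ x, φ x • u x := by
  rw [testPairing, innerSL_apply_apply, L2.inner_def]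
  refine integral_congr_ae ((MemLp.coeFn_toLp (memLp_ofReal hc hs)).mono fun x hx => ?_)
  simp only [hx, RCLike.inner_apply, Complex.conj_ofReal, Complex.real_smul]
  ring

/-- Each defining identity equates two continuous functionals. This gives completeness of `H¹`, on
which adjoints and Lax-Milgram rest. -/
theorem isClosed_sobolevH1 : IsClosed (sobolevH1 d : Set (WithLp 2 (L2 d × PiLp 2 fun _ : Fin d =>
    L2 d))) := by
  have : (sobolevH1 d : Set (WithLp 2 (L2 d × PiLp 2 fun _ : Fin d => L2 d)))
      = ⋂ (j : Fin d) (φ : Space d → ℝ) (hφ : IsTest φ),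
        {w | testPairing (partialDeriv j φ) (hφ.continuous_partialDeriv j)
            (hφ.hasCompactSupport_partialDeriv j) w.fst
          = - testPairing φ hφ.1.continuous hφ.2 (w.snd j)} := by
    ext w
    simp only [Set.mem_iInter, Set.mem_ofPred_eq, testPairing_apply]
    rfl
  rw [this]
  refine isClosed_iInter fun j => isClosed_iInter fun φ => isClosed_iInter fun hφ => ?_
  have h1 : Continuous fun w : WithLp 2 (L2 d × PiLp 2 fun _ : Fin d => L2 d) => w.fst :=
    WithLp.continuous_fst 2 _ _
  have h2 : Continuous fun w : WithLp 2 (L2 d × PiLp 2 fun _ : Fin d => L2 d) => w.snd j :=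
    (continuous_apply j).comp ((PiLp.continuous_ofLp 2 _).comp (WithLp.continuous_snd 2 _ _))
  exact isClosed_eq ((ContinuousLinearMap.continuous _).comp h1)
    ((ContinuousLinearMap.continuous _).comp h2).neg

instance instCompleteSpaceH1 : CompleteSpace (H1 d) := isClosed_sobolevH1.completeSpace_coe

instance instSeminormedAddCommGroupH1 : SeminormedAddCommGroup (H1 d) :=
  NormedAddCommGroup.toSeminormedAddCommGroup

instance instNormedSpaceH1 : NormedSpace ℂ (H1 d) := InnerProductSpace.toNormedSpace

instance instModuleH1 : Module ℂ (H1 d) := InnerProductSpace.toNormedSpace.toModule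

instance instInnerH1 : Inner ℂ (H1 d) := InnerProductSpace.toInner

theorem H1.inner_eq (v w : H1 d) :
    inner ℂ v w = inner ℂ v.toL2 w.toL2 + ∑ j, inner ℂ (v.deriv j) (w.deriv j) := by
  change inner ℂ v.1 w.1 = _
  rw [WithLp.prod_inner_apply]
  congr 1

theorem H1.norm_toL2_le (w : H1 d) : ‖w.toL2‖ ≤ ‖w‖ := by
  refine abs_le_of_sq_le_sq' ?_ (norm_nonneg _) |>.2
  rw [H1.norm_sq]
  exact le_add_of_nonneg_right (Finset.sum_nonneg fun _ _ => sq_nonneg _)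

theorem H1.norm_deriv_le (w : H1 d) (j : Fin d) : ‖w.deriv j‖ ≤ ‖w‖ := by
  refine abs_le_of_sq_le_sq' ?_ (norm_nonneg _) |>.2
  rw [H1.norm_sq]
  have := Finset.single_le_sum (f := fun j => ‖w.deriv j‖ ^ 2) (fun _ _ => sq_nonneg _)
    (Finset.mem_univ j)
  linarith [sq_nonneg ‖w.toL2‖]

/-- The inclusion `H¹ → L²` as a bounded operator. -/
def H1.toL2L : H1 d →L[ℂ] L2 d :=
  LinearMap.mkContinuous ⟨⟨H1.toL2, fun _ _ => rfl⟩, fun _ _ => rfl⟩ 1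
    fun w => by rw [one_mul]; exact w.norm_toL2_le

theorem H1.toL2L_apply (w : H1 d) : H1.toL2L w = w.toL2 := rfl

theorem H1.norm_toL2L_le : ‖(H1.toL2L : H1 d →L[ℂ] L2 d)‖ ≤ 1 :=
  LinearMap.mkContinuous_norm_le _ zero_le_one _

theorem H1.continuous_toL2 : Continuous (H1.toL2 (d := d)) := H1.toL2L.continuous

/-- The element of `H¹` with given value and weak derivatives. -/
def H1.mk (u : L2 d) (g : Fin d → L2 d) (h : ∀ j, IsWeakPartial j u (g j)) : H1 d :=
  ⟨WithLp.toLp 2 (u, WithLp.toLp 2 g), h⟩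

theorem H1.continuous_mk {X : Type*} [TopologicalSpace X] {u : X → L2 d} {g : X → Fin d → L2 d}
    (h : ∀ x j, IsWeakPartial j (u x) (g x j)) (hu : Continuous u)
    (hg : ∀ j, Continuous fun x => g x j) : Continuous fun x => H1.mk (u x) (g x) (h x) := by
  refine Continuous.subtype_mk ?_ _
  refine (WithLp.prod_continuous_toLp 2 _ _).comp (hu.prodMk ?_)
  exact (PiLp.continuous_toLp 2 _).comp (continuous_pi hg)

/-! ### Translations -/

theorem translate_add (a b : Space d) (f : L2 d) :
    translate a (translate b f) = translate (a + b) f := by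
  refine Lp.ext ?_
  have h1 := coeFn_translate a (translate b f)
  have h2 := (measurePreserving_sub_right volume a).quasiMeasurePreserving.ae
    (coeFn_translate b f)
  filter_upwards [h1, h2, coeFn_translate (a + b) f] with x h1 h2 h3
  rw [h1, h2, h3, sub_sub]

theorem translate_zero (f : L2 d) : translate 0 f = f := by
  refine Lp.ext ?_
  filter_upwards [coeFn_translate 0 f] with x h
  rw [h, sub_zero]

theorem norm_translate (a : Space d) (f : L2 d) : ‖translate a f‖ = ‖f‖ :=
  Lp.norm_compMeasurePreserving _ _

/-- Translation as a unitary operator on `L²`. -/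
def translateL (a : Space d) : L2 d ≃ₗᵢ[ℂ] L2 d where
  toFun := translate a
  map_add' := (Lp.compMeasurePreservingₗᵢ ℂ _ (measurePreserving_sub_right volume a)).map_add
  map_smul' := (Lp.compMeasurePreservingₗᵢ ℂ _ (measurePreserving_sub_right volume a)).map_smul
  invFun := translate (-a)
  left_inv f := by rw [translate_add, neg_add_cancel, translate_zero]
  right_inv f := by rw [translate_add, add_neg_cancel, translate_zero]
  norm_map' := norm_translate a

/-- Translation as a unitary operator on `H¹`. -/
def H1.translateL (a : Space d) : H1 d ≃ₗᵢ[ℂ] H1 d where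
  toFun := H1.translate a
  map_add' v w := H1.toL2_injective d ((Profile.translateL a).map_add v.toL2 w.toL2)
  map_smul' c w := H1.toL2_injective d ((Profile.translateL a).map_smul c w.toL2)
  invFun := H1.translate (-a)
  left_inv f := H1.toL2_injective d ((Profile.translateL a).left_inv f.toL2)
  right_inv f := H1.toL2_injective d ((Profile.translateL a).right_inv f.toL2)
  norm_map' w := by
    have h : ‖H1.translate a w‖ ^ 2 = ‖w‖ ^ 2 := by
      rw [H1.norm_sq, H1.norm_sq]
      congr 1
      · exact congrArg (· ^ 2) (norm_translate a _)
      · exact Finset.sum_congr rfl fun j _ => congrArg (· ^ 2) (norm_translate a (w.deriv j))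
    exact (sq_eq_sq₀ (norm_nonneg _) (norm_nonneg _)).1 h

theorem continuous_translate (f : L2 d) : Continuous fun a => translate a f := by
  refine Continuous.compMeasurePreservingLp (f := fun _ : Space d => f)
    (g := fun a : Space d => (⟨fun y => y - a, by fun_prop⟩ : C(Space d, Space d)))
    continuous_const ?_ _ (by norm_num)
  exact ContinuousMap.continuous_of_continuous_uncurry _ (by
    simp only [Function.uncurry_def, ContinuousMap.coe_mk]; fun_prop)

theorem H1.continuous_translate (w : H1 d) : Continuous fun a => H1.translate a w :=
  H1.continuous_mk _ (Profile.continuous_translate _) fun _ => Profile.continuous_translate _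

/-! ### Test functions in `H¹` -/

/-- Complex-valued test functions. -/
def IsCTest (f : Space d → ℂ) : Prop := ContDiff ℝ ∞ f ∧ HasCompactSupport f

theorem IsCTest.continuous_deriv {f : Space d → ℂ} (h : IsCTest f) (v : Space d) :
    Continuous fun x => fderiv ℝ f x v :=
  (h.1.continuous_fderiv (by simp)).clm_apply continuous_const

theorem IsCTest.hasCompactSupport_deriv {f : Space d → ℂ} (h : IsCTest f) (v : Space d) :
    HasCompactSupport fun x => fderiv ℝ f x v :=
  h.2.fderiv_apply ℝ v

/-- A complex test function as an element of `L²`. -/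
def IsCTest.toL2 {f : Space d → ℂ} (h : IsCTest f) : L2 d :=
  MemLp.toLp f (memLp_of_compactSupport h.1.continuous h.2 2)

theorem IsCTest.coeFn_toL2 {f : Space d → ℂ} (h : IsCTest f) : h.toL2 =ᵐ[volume] f :=
  MemLp.coeFn_toLp _

/-- The derivative of a complex test function as an element of `L²`. -/
def IsCTest.derivL2 {f : Space d → ℂ} (h : IsCTest f) (j : Fin d) : L2 d :=
  MemLp.toLp _ (memLp_of_compactSupport (h.continuous_deriv (EuclideanSpace.single j 1))
    (h.hasCompactSupport_deriv (EuclideanSpace.single j 1)) 2)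

theorem IsCTest.coeFn_derivL2 {f : Space d → ℂ} (h : IsCTest f) (j : Fin d) :
    h.derivL2 j =ᵐ[volume] fun x => fderiv ℝ f x (EuclideanSpace.single j 1) :=
  MemLp.coeFn_toLp _

theorem IsCTest.isWeakPartial {f : Space d → ℂ} (h : IsCTest f) (j : Fin d) :
    IsWeakPartial j h.toL2 (h.derivL2 j) := by
  intro φ hφ
  have e1 : ∫ x, partialDeriv j φ x • h.toL2 x
      = ∫ x, fderiv ℝ φ x (EuclideanSpace.single j 1) • f x :=
    integral_congr_ae (h.coeFn_toL2.mono fun x hx => by simp only [hx, partialDeriv])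
  have e2 : ∫ x, φ x • h.derivL2 j x = ∫ x, φ x • fderiv ℝ f x (EuclideanSpace.single j 1) :=
    integral_congr_ae ((h.coeFn_derivL2 j).mono fun x hx => by simp only [hx])
  rw [e1, e2, integral_smul_fderiv_eq_neg_fderiv_smul_of_integrable, neg_neg]
  · exact ((hφ.continuous_partialDeriv j).smul h.1.continuous).integrable_of_hasCompactSupport
      (hφ.hasCompactSupport_partialDeriv j).smul_right
  · exact (hφ.1.continuous.smul (h.continuous_deriv _)).integrable_of_hasCompactSupport
      hφ.2.smul_right
  · exact (hφ.1.continuous.smul h.1.continuous).integrable_of_hasCompactSupport hφ.2.smul_right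
  · exact fun x _ => hφ.1.differentiable (by simp) x
  · exact fun x _ => h.1.differentiable (by simp) x

/-- A complex test function as an element of `H¹`. -/
def IsCTest.toH1 {f : Space d → ℂ} (h : IsCTest f) : H1 d :=
  H1.mk h.toL2 h.derivL2 h.isWeakPartial

theorem IsTest.isCTest {φ : Space d → ℝ} (h : IsTest φ) : IsCTest fun x => (φ x : ℂ) :=
  ⟨Complex.ofRealCLM.contDiff.comp h.1, h.2.comp_left Complex.ofReal_zero⟩

theorem IsCTest.re {f : Space d → ℂ} (h : IsCTest f) : IsTest fun x => (f x).re :=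
  ⟨Complex.reCLM.contDiff.comp h.1, h.2.comp_left Complex.zero_re⟩

theorem IsCTest.im {f : Space d → ℂ} (h : IsCTest f) : IsTest fun x => (f x).im :=
  ⟨Complex.imCLM.contDiff.comp h.1, h.2.comp_left Complex.zero_im⟩

theorem IsCTest.toH1_eq {f : Space d → ℂ} (h : IsCTest f) :
    h.toH1 = h.re.isCTest.toH1 + Complex.I • h.im.isCTest.toH1 := by
  refine H1.toL2_injective d ?_
  change h.toL2 = h.re.isCTest.toL2 + Complex.I • h.im.isCTest.toL2
  refine Lp.ext ?_
  filter_upwards [h.coeFn_toL2, h.re.isCTest.coeFn_toL2, h.im.isCTest.coeFn_toL2,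
    Lp.coeFn_add h.re.isCTest.toL2 (Complex.I • h.im.isCTest.toL2),
    Lp.coeFn_smul Complex.I h.im.isCTest.toL2] with x h1 h2 h3 h4 h5
  rw [h4, Pi.add_apply, h5, Pi.smul_apply, h1, h2, h3, smul_eq_mul, mul_comm]
  exact (Complex.re_add_im _).symm

end Sobolev

/-! ### Density of test functions in `H¹` -/

section Density

variable {d : ℕ}

open scoped Convolution in
/-- The mollification of a compactly supported function is a test function. -/
theorem IsTest.isCTest_convolution {ρ : Space d → ℝ} (hρ : IsTest ρ) {g : Space d → ℂ}
    (hg : HasCompactSupport g) (hgi : Integrable g) :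
    IsCTest (ρ ⋆[ContinuousLinearMap.lsmul ℝ ℝ, volume] g) :=
  ⟨hρ.2.contDiff_convolution_left _ hρ.1 hgi.locallyIntegrable, hρ.2.convolution _ hg⟩

theorem H1.integrable_smul_translate {ρ : Space d → ℝ} (hρ : IsTest ρ) (w : H1 d) :
    Integrable fun a => ρ a • H1.translate a w :=
  (hρ.1.continuous.smul (H1.continuous_translate w)).integrable_of_hasCompactSupport
    hρ.2.smul_right

open scoped Convolution in
-- A mollification is an average of translates, here as an `H¹`-valued integral; pairing with a test
-- function reduces this to Fubini.
theorem toH1_convolution {ρ : Space d → ℝ} (hρ : IsTest ρ) {g : Space d → ℂ}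
    (hg : HasCompactSupport g) (hgi : Integrable g) {w : H1 d} (hw : w.toL2 =ᵐ[volume] g) :
    (hρ.isCTest_convolution hg hgi).toH1 = ∫ a, ρ a • H1.translate a w := by
  refine H1.toL2_injective d (L2.eq_of_test _ _ fun φ hφ => ?_)
  have e1 : ∫ x, φ x • (hρ.isCTest_convolution hg hgi).toH1.toL2 x
      = ∫ x, ∫ a, φ x • (ρ a • g (x - a)) := by
    refine integral_congr_ae ((hρ.isCTest_convolution hg hgi).coeFn_toL2.mono fun x hx => ?_)
    have : (hρ.isCTest_convolution hg hgi).toH1.toL2 = (hρ.isCTest_convolution hg hgi).toL2 := rfl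
    simp only [this, hx]
    rw [integral_smul]
    rfl
  have e2 : ∫ x, φ x • (∫ a, ρ a • H1.translate a w).toL2 x
      = ∫ a, ∫ x, φ x • (ρ a • g (x - a)) := by
    rw [← testPairing_apply φ hφ.1.continuous hφ.2, ← H1.toL2L_apply,
      ← ContinuousLinearMap.integral_comp_comm _ (H1.integrable_smul_translate hρ w),
      ← ContinuousLinearMap.integral_comp_comm _
        ((H1.toL2L).integrable_comp (H1.integrable_smul_translate hρ w))]
    refine integral_congr_ae (.of_forall fun a => ?_)
    have h1 : H1.toL2L (ρ a • H1.translate a w) = (ρ a : ℂ) • translate a w.toL2 := rfl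
    simp only [h1, map_smul]
    rw [testPairing_apply, smul_eq_mul, ← integral_const_mul]
    have h2 := (measurePreserving_sub_right volume a).quasiMeasurePreserving.ae hw
    refine integral_congr_ae ?_
    filter_upwards [coeFn_translate a w.toL2, h2] with x hx1 hx2
    rw [hx1, hx2]
    simp only [Complex.real_smul]
    ring
  rw [e1, e2]
  refine integral_integral_swap ?_
  have hint : Integrable (fun p : Space d × Space d => ρ p.2 • g (p.1 - p.2))
      (volume.prod volume) := by
    have hρi : Integrable ρ := hρ.1.continuous.integrable_of_hasCompactSupport hρ.2
    exact hρi.convolution_integrand (ContinuousLinearMap.lsmul ℝ ℝ) hgi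
  obtain ⟨C, hC⟩ := hφ.2.exists_bound_of_continuous hφ.1.continuous
  exact hint.bdd_smul C (hφ.1.continuous.comp continuous_fst).aestronglyMeasurable
    (.of_forall fun p => hC p.1)

/-- The continuous function `a ↦ ⟨y, τ_a w⟩` integrates to zero against every test function `ρ`,
since the average of the translates is a mollification and thus a test function. So it vanishes
identically, in particular at `a = 0`; no approximate identity is needed. -/
theorem inner_eq_zero_of_compactSupport {y : H1 d}
    (hy : ∀ (f : Space d → ℂ) (hf : IsCTest f), inner ℂ y hf.toH1 = 0) {w : H1 d} {g : Space d → ℂ}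
    (hg : HasCompactSupport g) (hw : w.toL2 =ᵐ[volume] g) : inner ℂ y w = 0 := by
  have hgi : Integrable g := by
    have h1 : IntegrableOn w.toL2 (tsupport g) :=
      ((Lp.memLp w.toL2).locallyIntegrable (by norm_num)).integrableOn_isCompact hg
    have h2 : IntegrableOn g (tsupport g) := h1.congr_fun_ae (ae_restrict_of_ae hw)
    exact (integrableOn_iff_integrable_of_support_subset (subset_tsupport g)).1 h2
  have hc : Continuous fun a => inner ℂ y (H1.translate a w) :=
    continuous_const.inner (H1.continuous_translate w)
  have h0 : ∀ᵐ a : Space d, inner ℂ y (H1.translate a w) = 0 := by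
    refine ae_eq_zero_of_integral_contDiff_smul_eq_zero hc.locallyIntegrable fun ρ h1 h2 => ?_
    have hρ : IsTest ρ := ⟨h1, h2⟩
    have h3 := hy _ (hρ.isCTest_convolution hg hgi)
    rw [toH1_convolution hρ hg hgi hw, ← innerSL_apply_apply ℂ,
      ← ContinuousLinearMap.integral_comp_comm _ (H1.integrable_smul_translate hρ w)] at h3
    rw [← h3]
    refine integral_congr_ae (.of_forall fun a => ?_)
    have h4 : ρ a • H1.translate a w = (ρ a : ℂ) • H1.translate a w := rfl
    simp only [h4, map_smul, innerSL_apply_apply]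
    rw [Complex.real_smul, smul_eq_mul]
  have h5 : (fun a => inner ℂ y (H1.translate a w)) = fun _ => 0 :=
    Continuous.ae_eq_iff_eq volume hc continuous_const |>.1 h0
  have h6 := congrFun h5 0
  have h7 : H1.translate 0 w = w := H1.toL2_injective d (translate_zero w.toL2)
  rwa [h7] at h6

/-! ### Multiplication by bounded functions and cutoffs -/

theorem memLp_bdd_smul {ψ : Space d → ℝ} (hc : Continuous ψ) (hb : ∃ C, ∀ x, ‖ψ x‖ ≤ C) (u : L2 d) :
    MemLp (fun x => ψ x • u x) 2 volume := by
  obtain ⟨C, hC⟩ := hb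
  refine (Lp.memLp u).of_le_mul (c := C)
    (hc.aestronglyMeasurable.smul (Lp.aestronglyMeasurable u)) (.of_forall fun x => ?_)
  rw [norm_smul]
  gcongr
  exact hC x

/-- Multiplication of an `L²` function by a bounded continuous function. -/
def bddMul (ψ : Space d → ℝ) (hc : Continuous ψ) (hb : ∃ C, ∀ x, ‖ψ x‖ ≤ C) (u : L2 d) : L2 d :=
  (memLp_bdd_smul hc hb u).toLp

theorem coeFn_bddMul {ψ : Space d → ℝ} (hc : Continuous ψ) (hb : ∃ C, ∀ x, ‖ψ x‖ ≤ C) (u : L2 d) :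
    bddMul ψ hc hb u =ᵐ[volume] fun x => ψ x • u x := MemLp.coeFn_toLp _

theorem tendsto_inner_bddMul {ψ : ℕ → Space d → ℝ} (hc : ∀ n, Continuous (ψ n)) {C : ℝ}
    (hC : ∀ n x, ‖ψ n x‖ ≤ C) {c : ℝ} (hlim : ∀ x, Tendsto (fun n => ψ n x) atTop (𝓝 c))
    (y u : L2 d) : Tendsto (fun n => inner ℂ y (bddMul (ψ n) (hc n) ⟨C, hC n⟩ u)) atTop
      (𝓝 (c • inner ℂ y u)) := by
  have e : ∀ n, inner ℂ y (bddMul (ψ n) (hc n) ⟨C, hC n⟩ u)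
      = ∫ x, ψ n x • inner ℂ (y x) (u x) := fun n => by
    rw [L2.inner_def]
    refine integral_congr_ae ((coeFn_bddMul (hc n) ⟨C, hC n⟩ u).mono fun x hx => ?_)
    simp only [hx, inner_smul_right_eq_smul]
  have hi : Integrable fun x => inner ℂ (y x) (u x) := L2.integrable_inner y u
  simp only [e]
  rw [L2.inner_def, ← integral_smul]
  refine tendsto_integral_of_dominated_convergence (fun x => C * ‖inner ℂ (y x) (u x)‖)
    (fun n => (hc n).aestronglyMeasurable.smul hi.aestronglyMeasurable) (hi.norm.const_mul C)
    (fun n => .of_forall fun x => ?_) (.of_forall fun x => (hlim x).smul_const _)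
  rw [norm_smul]
  gcongr
  exact hC n x

theorem IsTest.bounded {χ : Space d → ℝ} (h : IsTest χ) : ∃ C, ∀ x, ‖χ x‖ ≤ C :=
  h.2.exists_bound_of_continuous h.1.continuous

theorem IsTest.bounded_partialDeriv {χ : Space d → ℝ} (h : IsTest χ) (j : Fin d) :
    ∃ C, ∀ x, ‖partialDeriv j χ x‖ ≤ C :=
  (h.hasCompactSupport_partialDeriv j).exists_bound_of_continuous (h.continuous_partialDeriv j)

/-- Leibniz' rule, by testing with `φ χ`: `χ ∂_jφ = ∂_j(φ χ) - φ ∂_jχ`. -/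
theorem isWeakPartial_mul {χ : Space d → ℝ} (h : IsTest χ) {j : Fin d} {u g : L2 d}
    (hu : IsWeakPartial j u g) : IsWeakPartial j (bddMul χ h.1.continuous h.bounded u)
      (bddMul χ h.1.continuous h.bounded g +
        bddMul (partialDeriv j χ) (h.continuous_partialDeriv j) (h.bounded_partialDeriv j) u) := by
  intro φ hφ
  have hφχ : IsTest fun x => φ x * χ x := ⟨hφ.1.mul h.1, hφ.2.mul_right⟩
  have hd : ∀ x, partialDeriv j (fun x => φ x * χ x) x
      = φ x * partialDeriv j χ x + χ x * partialDeriv j φ x := fun x => by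
    rw [partialDeriv, fderiv_fun_mul (hφ.1.differentiable (by simp) x)
      (h.1.differentiable (by simp) x)]
    rfl
  have i1 : Integrable fun x => (φ x * partialDeriv j χ x) • u x :=
    L2.integrable_smul u (hφ.1.continuous.mul (h.continuous_partialDeriv j)) hφ.2.mul_right
  have e1 : ∫ x, partialDeriv j φ x • bddMul χ h.1.continuous h.bounded u x
      = (∫ x, partialDeriv j (fun x => φ x * χ x) x • u x)
        - ∫ x, (φ x * partialDeriv j χ x) • u x := by
    rw [← integral_sub (L2.integrable_smul u (hφχ.continuous_partialDeriv j)
      (hφχ.hasCompactSupport_partialDeriv j)) i1]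
    refine integral_congr_ae ((coeFn_bddMul h.1.continuous h.bounded u).mono fun x hx => ?_)
    simp only [hx, hd, ← sub_smul, smul_smul]
    ring_nf
  have e2 : ∫ x, φ x • (bddMul χ h.1.continuous h.bounded g + bddMul (partialDeriv j χ)
        (h.continuous_partialDeriv j) (h.bounded_partialDeriv j) u : L2 d) x
      = (∫ x, (φ x * χ x) • g x) + ∫ x, (φ x * partialDeriv j χ x) • u x := by
    rw [← integral_add (L2.integrable_smul g hφχ.1.continuous hφχ.2) i1]
    refine integral_congr_ae ?_
    filter_upwards [Lp.coeFn_add (bddMul χ h.1.continuous h.bounded g) (bddMul (partialDeriv j χ)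
        (h.continuous_partialDeriv j) (h.bounded_partialDeriv j) u),
      coeFn_bddMul h.1.continuous h.bounded g,
      coeFn_bddMul (h.continuous_partialDeriv j) (h.bounded_partialDeriv j) u] with x h1 h2 h3
    rw [h1, Pi.add_apply, h2, h3, smul_add, smul_smul, smul_smul]
  rw [e1, e2, hu _ hφχ]
  ring

/-- The product of an `H¹` function with a test function. -/
def H1.cutoff {χ : Space d → ℝ} (h : IsTest χ) (w : H1 d) : H1 d :=
  H1.mk _ _ fun j => isWeakPartial_mul h (w.2 j)

/-- A sequence of cutoff functions exhausting the space. -/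
theorem exists_cutoff_seq (d : ℕ) : ∃ (χ : ℕ → Space d → ℝ) (C : ℝ), (∀ n, IsTest (χ n)) ∧
    (∀ n x, ‖χ n x‖ ≤ C) ∧ (∀ n j x, ‖partialDeriv j (χ n) x‖ ≤ C) ∧
    (∀ x, Tendsto (fun n => χ n x) atTop (𝓝 1)) ∧
    ∀ j x, Tendsto (fun n => partialDeriv j (χ n) x) atTop (𝓝 0) := by
  -- The cutoffs are `b (x / (n + 1))`; each derivative gains a factor `1 / (n + 1)`.
  let b : ContDiffBump (0 : Space d) := ⟨1, 2, one_pos, one_lt_two⟩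
  have hb : IsTest (b : Space d → ℝ) := ⟨b.contDiff, b.hasCompactSupport⟩
  obtain ⟨C₁, hC₁⟩ := hb.bounded
  choose C₂ hC₂ using hb.bounded_partialDeriv
  have hC₂0 : ∀ j, 0 ≤ C₂ j := fun j => (norm_nonneg _).trans (hC₂ j 0)
  let c : ℕ → ℝ := fun n => ((n : ℝ) + 1)⁻¹
  have hc0 : ∀ n, c n ≠ 0 := fun n => by positivity
  have hcp : ∀ n, 0 ≤ c n := fun n => by positivity
  have hc1 : ∀ n, c n ≤ 1 := fun n => inv_le_one_of_one_le₀ (by simp)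
  have hcl : Tendsto c atTop (𝓝 0) := by
    simpa [c] using tendsto_one_div_add_atTop_nhds_zero_nat (𝕜 := ℝ)
  have hderiv : ∀ n j x, partialDeriv j (fun x => b (c n • x)) x
      = c n * partialDeriv j b (c n • x) := fun n j x => by
    rw [partialDeriv, fderiv_comp_smul]
    rfl
  refine ⟨fun n x => b (c n • x), max C₁ (∑ j, C₂ j), fun n => ⟨?_, ?_⟩,
    fun n x => (hC₁ _).trans (le_max_left _ _), fun n j x => ?_, fun x => ?_, fun j x => ?_⟩
  · exact hb.1.comp (contDiff_const_smul _)
  · exact hb.2.comp_homeomorph (Homeomorph.smulOfNeZero (c n) (hc0 n))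
  · rw [hderiv, norm_mul, Real.norm_of_nonneg (hcp n)]
    calc _ ≤ 1 * C₂ j := by gcongr; exacts [hc1 n, hC₂ j _]
      _ ≤ ∑ j, C₂ j := by
        rw [one_mul]; exact Finset.single_le_sum (fun j _ => hC₂0 j) (Finset.mem_univ j)
      _ ≤ _ := le_max_right _ _
  · have h1 : Continuous fun s : ℝ => b (s • x) := hb.1.continuous.comp (by fun_prop)
    have h2 := (h1.tendsto' 0 1 (by
      rw [zero_smul]
      exact b.one_of_mem_closedBall (by simp [b]))).comp hcl
    exact h2
  · simp only [hderiv]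
    have hl : Tendsto (fun n => c n * C₂ j) atTop (𝓝 0) := by simpa using hcl.mul_const (C₂ j)
    refine squeeze_zero_norm (fun n => ?_) hl
    rw [norm_mul, Real.norm_of_nonneg (hcp n)]
    gcongr
    exact hC₂ j _

/-- `y` is orthogonal to its own compactly supported cutoffs, and their pairings with `y` tend to
`‖y‖²` by dominated convergence. -/
theorem H1.eq_zero_of_inner_isCTest {y : H1 d}
    (hy : ∀ (f : Space d → ℂ) (hf : IsCTest f), inner ℂ y hf.toH1 = 0) : y = 0 := by
  obtain ⟨χ, C, hχ, hC, hC', hl, hl'⟩ := exists_cutoff_seq d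
  have h0 : ∀ n, inner ℂ y (H1.cutoff (hχ n) y) = 0 := fun n =>
    inner_eq_zero_of_compactSupport hy (g := fun x => χ n x • y.toL2 x) (hχ n).2.smul_right
      (coeFn_bddMul (hχ n).1.continuous (hχ n).bounded y.toL2)
  have h1 : Tendsto (fun n => inner ℂ y (H1.cutoff (hχ n) y)) atTop (𝓝 (inner ℂ y y)) := by
    simp only [H1.inner_eq]
    refine Tendsto.add ?_ (tendsto_finsetSum _ fun j _ => ?_)
    · have l1 := tendsto_inner_bddMul (fun n => (hχ n).1.continuous) hC hl y.toL2 y.toL2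
      rw [one_smul] at l1
      exact l1
    · have l1 := tendsto_inner_bddMul (fun n => (hχ n).1.continuous) hC hl (y.deriv j) (y.deriv j)
      have l2 := tendsto_inner_bddMul (fun n => (hχ n).continuous_partialDeriv j)
        (fun n => hC' n j) (hl' j) (y.deriv j) y.toL2
      have l3 := l1.add l2
      simp only [← inner_add_right, one_smul, zero_smul, add_zero] at l3
      exact l3
  simp only [h0] at h1
  exact inner_self_eq_zero.1 (tendsto_nhds_unique h1 tendsto_const_nhds)

theorem H1.eq_zero_of_inner_isTest {y : H1 d}
    (hy : ∀ (φ : Space d → ℝ) (hφ : IsTest φ), inner ℂ y hφ.isCTest.toH1 = 0) : y = 0 :=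
  H1.eq_zero_of_inner_isCTest fun f hf => by
    have h := inner_smul_right y hf.im.isCTest.toH1 Complex.I
    rw [hy _ hf.im, mul_zero] at h
    rw [hf.toH1_eq, inner_add_right, hy _ hf.re, zero_add]
    exact h

theorem IsCTest.add {f g : Space d → ℂ} (hf : IsCTest f) (hg : IsCTest g) : IsCTest (f + g) :=
  ⟨hf.1.add hg.1, hf.2.add hg.2⟩

theorem IsCTest.const_smul {f : Space d → ℂ} (hf : IsCTest f) (c : ℂ) : IsCTest (c • f) :=
  ⟨contDiff_const.smul hf.1, hf.2.smul_left⟩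

theorem isCTest_zero : IsCTest (0 : Space d → ℂ) := ⟨contDiff_const, HasCompactSupport.zero⟩

/-- The subspace of test functions in `H¹`. -/
def testSubmodule (d : ℕ) : Submodule ℂ (H1 d) where
  carrier := {w | ∃ (f : Space d → ℂ) (hf : IsCTest f), hf.toH1 = w}
  zero_mem' := ⟨0, isCTest_zero, H1.toL2_injective d (MemLp.toLp_zero
    (memLp_of_compactSupport isCTest_zero.1.continuous isCTest_zero.2 2))⟩
  add_mem' := by
    rintro _ _ ⟨f, hf, rfl⟩ ⟨g, hg, rfl⟩
    exact ⟨f + g, hf.add hg, H1.toL2_injective d (MemLp.toLp_add (memLp_of_compactSupport hf.1.continuous hf.2 2)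
      (memLp_of_compactSupport hg.1.continuous hg.2 2))⟩
  smul_mem' := by
    rintro c _ ⟨f, hf, rfl⟩
    exact ⟨c • f, hf.const_smul c, H1.toL2_injective d (MemLp.toLp_const_smul c
      (memLp_of_compactSupport hf.1.continuous hf.2 2))⟩

theorem dense_testSubmodule : Dense (testSubmodule d : Set (H1 d)) := by
  rw [Submodule.dense_iff_topologicalClosure_eq_top, Submodule.topologicalClosure_eq_top_iff,
    Submodule.eq_bot_iff]
  intro y hy
  refine H1.eq_zero_of_inner_isCTest fun f hf => ?_
  have hm : hf.toH1 ∈ testSubmodule d := ⟨f, hf, rfl⟩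
  exact (Submodule.mem_orthogonal' _ y).1 hy _ hm

theorem denseRange_subtype_testSubmodule : DenseRange (Subtype.val : testSubmodule d → H1 d) :=
  dense_testSubmodule.denseRange_val

theorem denseRange_toL2L : DenseRange (H1.toL2L : H1 d →L[ℂ] L2 d) := by
  refine denseRange_of_orthogonal fun v hv => L2.eq_zero_of_test v fun φ hφ => ?_
  rw [← testPairing_apply φ hφ.1.continuous hφ.2, testPairing, innerSL_apply_apply]
  have e : H1.toL2L hφ.isCTest.toH1 = MemLp.toLp _ (memLp_ofReal hφ.1.continuous hφ.2) := rfl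
  rw [← e]
  exact hv _

end Density

/-! ### The Sobolev inequality and multiplication operators `H¹ → L²` -/

section SobolevInequality

variable {d : ℕ}

/-- The critical Sobolev exponent `2⋆ = 2d/(d-2)`. -/
def sobolevExp (d : ℕ) : NNReal := ((2 : NNReal)⁻¹ - (d : NNReal)⁻¹)⁻¹

theorem inv_lt_half (hd : 3 ≤ d) : (d : NNReal)⁻¹ < 2⁻¹ := by
  have : (3 : NNReal) ≤ d := by exact_mod_cast hd
  gcongr
  exact lt_of_lt_of_le (by norm_num) this

/-- Subtraction in `NNReal` is truncated; `inv_lt_half` makes it a genuine one for `d ≥ 3`. -/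
theorem inv_sobolevExp (hd : 3 ≤ d) : ((sobolevExp d : ℝ))⁻¹ = 2⁻¹ - (d : ℝ)⁻¹ := by
  rw [sobolevExp, NNReal.coe_inv, inv_inv, NNReal.coe_sub (inv_lt_half hd).le]
  simp

theorem sobolevExp_pos (hd : 3 ≤ d) : 0 < sobolevExp d :=
  inv_pos.2 (tsub_pos_of_lt (inv_lt_half hd))

/-- The exponent relation `1/d + 1/2⋆ = 1/2`, by which multipliers in `L^d` send `H¹` to `L²`. -/
theorem holderTriple_sobolevExp (hd : 3 ≤ d) :
    ENNReal.HolderTriple (d : ℝ≥0∞) (sobolevExp d : ℝ≥0∞) 2 := by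
  constructor
  have h1 : (d : NNReal) ≠ 0 := by positivity
  have h : (d : NNReal)⁻¹ + (sobolevExp d)⁻¹ = 2⁻¹ := by
    rw [sobolevExp, inv_inv, add_tsub_cancel_of_le (inv_lt_half hd).le]
  have := congrArg ENNReal.ofNNReal h
  rw [ENNReal.coe_add, ENNReal.coe_inv h1, ENNReal.coe_inv (sobolevExp_pos hd).ne',
    ENNReal.coe_inv two_ne_zero, ENNReal.coe_natCast] at this
  exact this

theorem norm_le_sum_single {F : Type*} [NormedAddCommGroup F] [NormedSpace ℝ F]
    (T : Space d →L[ℝ] F) : ‖T‖ ≤ ∑ j, ‖T (EuclideanSpace.single j 1)‖ := by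
  refine T.opNorm_le_bound (Finset.sum_nonneg fun _ _ => norm_nonneg _) fun v => ?_
  conv_lhs => rw [← (EuclideanSpace.basisFun (Fin d) ℝ).sum_repr v]
  rw [map_sum, Finset.sum_mul]
  refine (norm_sum_le _ _).trans (Finset.sum_le_sum fun j _ => ?_)
  rw [map_smul, norm_smul, mul_comm]
  simp only [EuclideanSpace.basisFun_apply, EuclideanSpace.basisFun_repr]
  gcongr
  exact PiLp.norm_apply_le v j

theorem IsCTest.eLpNorm_fderiv_le {f : Space d → ℂ} (h : IsCTest f) :
    eLpNorm (fderiv ℝ f) 2 volume ≤ d * ENNReal.ofReal ‖h.toH1‖ := by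
  have hm : ∀ j : Fin d, AEStronglyMeasurable
      (fun x => ‖fderiv ℝ f x (EuclideanSpace.single j 1)‖) volume := fun j =>
    (h.continuous_deriv _).norm.aestronglyMeasurable
  calc eLpNorm (fderiv ℝ f) 2 volume
      ≤ eLpNorm (∑ j, fun x => ‖fderiv ℝ f x (EuclideanSpace.single j 1)‖) 2 volume := by
        refine eLpNorm_mono_real fun x => ?_
        rw [Finset.sum_apply]
        exact norm_le_sum_single _
    _ ≤ ∑ j : Fin d, eLpNorm (fun x => ‖fderiv ℝ f x (EuclideanSpace.single j 1)‖) 2 volume :=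
        eLpNorm_sum_le (fun j _ => hm j) (by norm_num)
    _ ≤ ∑ _j : Fin d, ENNReal.ofReal ‖h.toH1‖ := by
        refine Finset.sum_le_sum fun j _ => ?_
        rw [eLpNorm_norm, ← eLpNorm_congr_ae (h.coeFn_derivL2 j), L2.eLpNorm_eq]
        exact ENNReal.ofReal_le_ofReal (h.toH1.norm_deriv_le j)
    _ = d * ENNReal.ofReal ‖h.toH1‖ := by simp

/-- The Sobolev inequality on `H¹`. -/
theorem exists_sobolev_const (hd : 3 ≤ d) : ∃ C : NNReal, ∀ w : H1 d,
    eLpNorm w.toL2 (sobolevExp d) volume ≤ C * ENNReal.ofReal ‖w‖ := by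
  set C := SNormLESNormFDerivOfEqConst ℂ (volume : Measure (Space d)) 2 * (d : NNReal)
  have htest : ∀ (f : Space d → ℂ) (h : IsCTest f),
      eLpNorm h.toH1.toL2 (sobolevExp d) volume ≤ C * ENNReal.ofReal ‖h.toH1‖ := by
    intro f h
    have hfr : Module.finrank ℝ (Space d) = d := by simp
    have h1 := eLpNorm_le_eLpNorm_fderiv_of_eq (volume : Measure (Space d)) (u := f) (p := 2)
      (p' := sobolevExp d) (h.1.of_le (by simp)) h.2 (by norm_num) (by rw [hfr]; omega)
      (by rw [hfr]; exact inv_sobolevExp hd)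
    have h2 : (h.toH1.toL2 : Space d → ℂ) =ᵐ[volume] f := h.coeFn_toL2
    rw [eLpNorm_congr_ae h2]
    refine h1.trans ?_
    rw [ENNReal.coe_mul, mul_assoc]
    exact mul_le_mul_right h.eLpNorm_fderiv_le _
  refine ⟨C, fun w => ?_⟩
  -- Approximation by test functions, then Fatou along a subsequence that converges almost
  -- everywhere.
  obtain ⟨v, hv, hvw⟩ := mem_closure_iff_seq_limit.1 (dense_testSubmodule w)
  obtain ⟨ns, hns, hae⟩ := (tendstoInMeasure_of_tendsto_Lp
    ((H1.continuous_toL2.tendsto w).comp hvw)).exists_seq_tendsto_ae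
  refine (Lp.eLpNorm_lim_le_liminf_eLpNorm (fun n => Lp.aestronglyMeasurable _) _ hae).trans ?_
  have hl : Tendsto (fun n => (C : ℝ≥0∞) * ENNReal.ofReal ‖v (ns n)‖) atTop
      (𝓝 (C * ENNReal.ofReal ‖w‖)) := by
    refine ENNReal.Tendsto.const_mul ?_ (.inr ENNReal.coe_ne_top)
    exact ENNReal.tendsto_ofReal ((hvw.comp hns.tendsto_atTop).norm)
  rw [← hl.liminf_eq]
  refine liminf_le_liminf (.of_forall fun n => ?_)
  obtain ⟨f, hf, hfv⟩ := hv (ns n)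
  rw [Function.comp_apply, ← hfv]
  exact htest f hf

/-- The constant of the Sobolev inequality. -/
def sobolevConst (hd : 3 ≤ d) : NNReal := (exists_sobolev_const hd).choose

theorem H1.eLpNorm_sobolev_le (hd : 3 ≤ d) (w : H1 d) :
    eLpNorm w.toL2 (sobolevExp d) volume ≤ sobolevConst hd * ENNReal.ofReal ‖w‖ :=
  (exists_sobolev_const hd).choose_spec w

theorem eLpNorm_smul_le_sobolev (hd : 3 ≤ d) {g : Space d → ℝ} (hg : MemLp g d volume)
    (w : H1 d) : eLpNorm (fun x => g x • w.toL2 x) 2 volume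
      ≤ eLpNorm g d volume * (sobolevConst hd * ENNReal.ofReal ‖w‖) := by
  have := holderTriple_sobolevExp hd
  refine (eLpNorm_smul_le_mul_eLpNorm (p := (d : ℝ≥0∞)) (q := (sobolevExp d : ℝ≥0∞))
    (Lp.aestronglyMeasurable w.toL2) hg.1).trans ?_
  gcongr
  exact w.eLpNorm_sobolev_le hd

theorem memLp_smul_sobolev (hd : 3 ≤ d) {g : Space d → ℝ} (hg : MemLp g d volume) (w : H1 d) :
    MemLp (fun x => g x • w.toL2 x) 2 volume :=
  ⟨hg.1.smul (Lp.aestronglyMeasurable w.toL2), (eLpNorm_smul_le_sobolev hd hg w).trans_lt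
    (ENNReal.mul_lt_top hg.2 (ENNReal.mul_lt_top ENNReal.coe_lt_top ENNReal.ofReal_lt_top))⟩

theorem norm_toLp_smul_le (hd : 3 ≤ d) {g : Space d → ℝ} (hg : MemLp g d volume) (w : H1 d) :
    ‖(memLp_smul_sobolev hd hg w).toLp‖
      ≤ (sobolevConst hd * (eLpNorm g d volume).toReal) * ‖w‖ := by
  rw [Lp.norm_toLp]
  refine ENNReal.toReal_le_of_le_ofReal (by positivity) ((eLpNorm_smul_le_sobolev hd hg w).trans ?_)
  rw [ENNReal.ofReal_mul (by positivity), ENNReal.ofReal_mul (by positivity),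
    ENNReal.ofReal_toReal hg.2.ne, ENNReal.ofReal_coe_nnreal]
  exact le_of_eq (by ring)

/-- Multiplication by `g ∈ L^d` as a bounded operator from `H¹` to `L²`. -/
def sobolevMul (hd : 3 ≤ d) (g : Space d → ℝ) (hg : MemLp g d volume) : H1 d →L[ℂ] L2 d :=
  LinearMap.mkContinuous
    { toFun := fun w => (memLp_smul_sobolev hd hg w).toLp
      map_add' := fun v w => by
        rw [← MemLp.toLp_add]
        refine MemLp.toLp_congr _ _ ?_
        filter_upwards [Lp.coeFn_add v.toL2 w.toL2] with x hx
        have : (v + w).toL2 = v.toL2 + w.toL2 := rfl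
        rw [this, hx, Pi.add_apply, Pi.add_apply, smul_add]
      map_smul' := fun c w => by
        rw [RingHom.id_apply, ← MemLp.toLp_const_smul]
        refine MemLp.toLp_congr _ _ ?_
        filter_upwards [Lp.coeFn_smul c w.toL2] with x hx
        have : (c • w).toL2 = c • w.toL2 := rfl
        rw [this, hx, Pi.smul_apply, Pi.smul_apply, smul_comm] }
    (sobolevConst hd * (eLpNorm g d volume).toReal) (norm_toLp_smul_le hd hg)

theorem coeFn_sobolevMul (hd : 3 ≤ d) {g : Space d → ℝ} (hg : MemLp g d volume) (w : H1 d) :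
    sobolevMul hd g hg w =ᵐ[volume] fun x => g x • w.toL2 x :=
  MemLp.coeFn_toLp (memLp_smul_sobolev hd hg w)

theorem norm_sobolevMul_apply_le (hd : 3 ≤ d) {g : Space d → ℝ} (hg : MemLp g d volume)
    (w : H1 d) :
    ‖sobolevMul hd g hg w‖ ≤ (sobolevConst hd * (eLpNorm g d volume).toReal) * ‖w‖ :=
  norm_toLp_smul_le hd hg w

/-- For `|a| > r₁ + r₂` the supports of `h` and of the translated test function are disjoint, so
only the small remainder `g - h` acts. -/
theorem sobolevMul_translate_eq (hd : 3 ≤ d) {g h : Space d → ℝ} (hg : MemLp g d volume)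
    (hgh : MemLp (g - h) d volume) {f : Space d → ℂ} (hf : IsCTest f) {r₁ r₂ : ℝ}
    (hr₁ : tsupport h ⊆ Metric.closedBall 0 r₁) (hr₂ : tsupport f ⊆ Metric.closedBall 0 r₂)
    {a : Space d} (ha : r₁ + r₂ < ‖a‖) :
    sobolevMul hd g hg (H1.translate a hf.toH1)
      = sobolevMul hd (g - h) hgh (H1.translate a hf.toH1) := by
  refine Lp.ext ?_
  have h2 := (measurePreserving_sub_right volume a).quasiMeasurePreserving.ae hf.coeFn_toL2
  filter_upwards [coeFn_sobolevMul hd hg (H1.translate a hf.toH1),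
    coeFn_sobolevMul hd hgh (H1.translate a hf.toH1),
    coeFn_translate a hf.toL2, h2] with y h1 h2 h3 h4
  have h5 : (H1.translate a hf.toH1).toL2 = translate a hf.toL2 := rfl
  rw [h1, h2, h5, h3, h4, Pi.sub_apply, sub_smul, eq_comm, sub_eq_self]
  by_contra hne
  obtain ⟨n1, n2⟩ := smul_ne_zero_iff.1 hne
  have b1 := hr₁ (subset_tsupport _ n1)
  have b2 := hr₂ (subset_tsupport _ n2)
  rw [mem_closedBall_zero_iff] at b1 b2
  have := norm_sub_norm_le a y
  rw [norm_sub_rev] at this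
  linarith

theorem H1.norm_translate (a : Space d) (w : H1 d) : ‖H1.translate a w‖ = ‖w‖ :=
  (H1.translateL a).norm_map w

theorem tendsto_sobolevMul_translate_test (hd : 3 ≤ d) {g : Space d → ℝ} (hg : MemLp g d volume)
    {x : ℕ → Space d} (hx : Tendsto (fun n => ‖x n‖) atTop atTop) {f : Space d → ℂ}
    (hf : IsCTest f) :
    Tendsto (fun n => sobolevMul hd g hg (H1.translate (x n) hf.toH1)) atTop (𝓝 0) := by
  rw [tendsto_zero_iff_norm_tendsto_zero, Metric.tendsto_atTop']
  intro ε hε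
  obtain ⟨K, hK⟩ : ∃ K, K = (sobolevConst hd : ℝ) * ‖hf.toH1‖ := ⟨_, rfl⟩
  have hK0 : 0 ≤ K := hK ▸ by positivity
  -- `K + 1` rather than `K` in the tolerance, since `K` may vanish.
  obtain ⟨h, hhs, hh, hhc, hhm⟩ := hg.exists_hasCompactSupport_eLpNorm_sub_le
    (by simp) (ε := ENNReal.ofReal (ε / (2 * (K + 1)))) (by simpa using by positivity)
  obtain ⟨r₁, hr₁⟩ := hhs.isBounded.subset_closedBall 0
  obtain ⟨r₂, hr₂⟩ := hf.2.isBounded.subset_closedBall 0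
  obtain ⟨N, hN⟩ := eventually_atTop.1 (hx.eventually_gt_atTop (r₁ + r₂))
  refine ⟨N, fun n hn => ?_⟩
  have hgh : MemLp (g - h) d volume := hg.sub hhm
  have h6 := norm_sobolevMul_apply_le hd hgh (H1.translate (x n) hf.toH1)
  rw [← sobolevMul_translate_eq hd hg hgh hf hr₁ hr₂ (hN n hn.le), H1.norm_translate,
    mul_right_comm, ← hK] at h6
  have hn1 : (eLpNorm (g - h) d volume).toReal ≤ ε / (2 * (K + 1)) :=
    ENNReal.toReal_le_of_le_ofReal (by positivity) hh
  rw [Real.dist_0_eq_abs, abs_of_nonneg (norm_nonneg _)]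
  refine h6.trans_lt ?_
  calc _ ≤ K * (ε / (2 * (K + 1))) := by gcongr
    _ ≤ (K + 1) * (ε / (2 * (K + 1))) := by gcongr; linarith
    _ = ε / 2 := by field_simp
    _ < ε := half_lt_self hε

/-- Multiplication by `g ∈ L^d` composed with a translation. -/
def sobolevMulTranslate (hd : 3 ≤ d) (g : Space d → ℝ) (hg : MemLp g d volume) (a : Space d) :
    H1 d →L[ℂ] L2 d :=
  (sobolevMul hd g hg).comp ((H1.translateL a).toContinuousLinearEquiv : H1 d →L[ℂ] H1 d)

theorem sobolevMulTranslate_apply (hd : 3 ≤ d) {g : Space d → ℝ} (hg : MemLp g d volume)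
    (a : Space d) (w : H1 d) :
    sobolevMulTranslate hd g hg a w = sobolevMul hd g hg (H1.translate a w) := rfl

theorem norm_sobolevMulTranslate_le (hd : 3 ≤ d) {g : Space d → ℝ} (hg : MemLp g d volume)
    (a : Space d) :
    ‖sobolevMulTranslate hd g hg a‖ ≤ sobolevConst hd * (eLpNorm g d volume).toReal := by
  refine ContinuousLinearMap.opNorm_le_bound _ (by positivity) fun u => ?_
  rw [sobolevMulTranslate_apply, ← H1.norm_translate a u]
  exact norm_sobolevMul_apply_le hd hg _

/-- Multiplication by `g ∈ L^d` annihilates profiles translated to infinity. -/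
theorem tendsto_sobolevMul_translate (hd : 3 ≤ d) {g : Space d → ℝ} (hg : MemLp g d volume)
    {x : ℕ → Space d} (hx : Tendsto (fun n => ‖x n‖) atTop atTop) (w : H1 d) :
    Tendsto (fun n => sobolevMul hd g hg (H1.translate (x n) w)) atTop (𝓝 0) := by
  refine tendsto_apply_of_denseRange (T := fun n => sobolevMulTranslate hd g hg (x n)) (T₀ := 0)
    (.of_forall fun n => norm_sobolevMulTranslate_le hd hg (x n))
    denseRange_subtype_testSubmodule ?_ w
  rintro ⟨_, f, hf, rfl⟩
  exact tendsto_sobolevMul_translate_test hd hg hx hf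

/-- `(√V)^d = V^{d/2}`: the integrability of `V` is exactly what makes `√V` an admissible
multiplier. -/
theorem memLp_sqrt {V : Space d → ℝ} (hV0 : ∀ x, 0 ≤ V x)
    (hV : MemLp V ((d : ℝ≥0∞) / 2) volume) : MemLp (fun x => Real.sqrt (V x)) d volume := by
  have h := hV.norm_rpow_div (2⁻¹ : ℝ≥0∞)
  have e : (d : ℝ≥0∞) / 2 / 2⁻¹ = d := by
    rw [div_eq_mul_inv, inv_inv, ENNReal.div_mul_cancel two_ne_zero ENNReal.ofNat_ne_top]
  rw [e] at h
  convert h using 2 with x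
  rw [Real.norm_of_nonneg (hV0 x), Real.sqrt_eq_rpow]
  simp

/-- The integral of `|u|^p`, `2 ≤ p ≤ q`, is controlled by those of `|u|²` and `|u|^q`. -/
theorem lintegral_rpow_le_add {u : Space d → ℂ} (hu : AEStronglyMeasurable u volume) {p q : ℝ}
    (h2 : 2 ≤ p) (hpq : p ≤ q) :
    ∫⁻ x, ‖u x‖ₑ ^ p ≤ (∫⁻ x, ‖u x‖ₑ ^ (2 : ℝ)) + ∫⁻ x, ‖u x‖ₑ ^ q := by
  rw [← lintegral_add_left' (hu.enorm.pow_const _)]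
  refine lintegral_mono fun x => ?_
  rcases le_total ‖u x‖ₑ 1 with h | h
  · exact (ENNReal.rpow_le_rpow_of_exponent_ge h h2).trans le_self_add
  · exact (ENNReal.rpow_le_rpow_of_exponent_le h hpq).trans le_add_self

theorem eLpNorm_rpow_eq {u : Space d → ℂ} {p : ℝ} (hp : 0 < p) :
    eLpNorm u (ENNReal.ofReal p) volume ^ p = ∫⁻ x, ‖u x‖ₑ ^ p := by
  rw [eLpNorm_eq_lintegral_rpow_enorm_toReal (by simpa using hp) ENNReal.ofReal_ne_top,
    ENNReal.toReal_ofReal hp.le, ← ENNReal.rpow_mul, one_div, inv_mul_cancel₀ hp.ne',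
    ENNReal.rpow_one]

end SobolevInequality

/-! ### Form bounds, the perturbation form and weakly null sequences -/

section Abstract

variable {H E K : Type*} [NormedAddCommGroup H] [InnerProductSpace ℂ H] [CompleteSpace H]
  [NormedAddCommGroup E] [InnerProductSpace ℂ E] [CompleteSpace E]
  [NormedAddCommGroup K] [InnerProductSpace ℂ K] [CompleteSpace K]
  {J : E →L[ℂ] H} {M : E →L[ℂ] K}

/-- The residual `formOp M w - J* f` is orthogonal to a total family. It serves to test the weak
equation with real test functions only. -/
theorem eq_formSolve_of_orthogonal {ι : Type*} {e : ι → E} {w : E} {f : H}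
    (he : ∀ y, (∀ i, inner ℂ y (e i) = 0) → y = 0)
    (h : ∀ i, inner ℂ (e i) w + inner ℂ (M (e i)) (M w) = inner ℂ (J (e i)) f) :
    w = formSolve J M f := by
  have hy : formOp M w - J.adjoint f = 0 := he _ fun i => by
    rw [inner_sub_left, inner_formOp_left, ContinuousLinearMap.adjoint_inner_left, sub_eq_zero]
    have h2 := congrArg (starRingEnd ℂ) (h i)
    rwa [map_add, inner_conj_symm, inner_conj_symm, inner_conj_symm] at h2
  refine eq_formSolve fun v => ?_
  rw [← inner_formOp_right, sub_eq_zero.1 hy, ContinuousLinearMap.adjoint_inner_right]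

/-- Norm equivalence on the domain of the operator associated with a form. -/
theorem form_bounds {u f : H} (h : u = formResolvent J M (f + u)) :
    ∃ w, J w = u ∧ ‖w‖ ^ 2 ≤ (inner ℂ u f).re + ‖u‖ ^ 2 ∧
      (inner ℂ u f).re + ‖u‖ ^ 2 ≤ (1 + ‖M‖ ^ 2) * ‖w‖ ^ 2 := by
  refine ⟨formSolve J M (f + u), h.symm, ?_⟩
  set w := formSolve J M (f + u) with hw
  have h1 : inner ℂ w w + inner ℂ (M w) (M w) = inner ℂ (J w) (f + u) := inner_formSolve w (f + u)
  have h2 : J w = u := h.symm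
  rw [h2, inner_add_right] at h1
  have h3 : (inner ℂ u f).re + ‖u‖ ^ 2 = ‖w‖ ^ 2 + ‖M w‖ ^ 2 := by
    simp only [inner_self_eq_norm_sq_to_K] at h1
    have := congrArg Complex.re h1
    simp only [Complex.add_re] at this
    norm_cast at this
    exact this.symm
  have h4 : ‖M w‖ ^ 2 ≤ ‖M‖ ^ 2 * ‖w‖ ^ 2 := by
    rw [← mul_pow]; gcongr; exact M.le_opNorm w
  rw [h3]
  constructor <;> nlinarith [sq_nonneg ‖M w‖]

/-- The bounded sesquilinear form `(u, v) ↦ (M u, M v)`. -/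
def formPert (M : E →L[ℂ] K) : E →L[ℂ] E →L⋆[ℂ] ℂ := (innerSLFlip ℂ) ∘L (M.adjoint ∘L M)

theorem formPert_apply (u v : E) : formPert M u v = inner ℂ (M v) (M u) :=
  (ContinuousLinearMap.adjoint_inner_right M v (M u) : _)

/-- The weak equation of `u` tested with `v`; `v` may be any element of the form domain. -/
theorem formPert_eq (hinj : Function.Injective J) {u v : E} {f : H}
    (h : J u = formResolvent J M (f + J u)) :
    formPert M u v = inner ℂ (J v) f + inner ℂ (J v) (J u) - inner ℂ v u := by
  have hu : u = formSolve J M (f + J u) := hinj h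
  have h1 := inner_formSolve (J := J) (M := M) v (f + J u)
  rw [← hu, inner_add_right] at h1
  rw [formPert_apply, ← h1]
  ring

theorem eq_of_eqOn_denseRange {E F : Type*} [NormedAddCommGroup E] [InnerProductSpace ℂ E] {e : F → E} (he : DenseRange e)
    {B B' : E →L[ℂ] E →L⋆[ℂ] ℂ} (h : ∀ x y, B (e x) (e y) = B' (e x) (e y)) : B = B' := by
  refine ContinuousLinearMap.ext fun u => ContinuousLinearMap.ext fun v => ?_
  refine he.induction_on (p := fun u => B u v = B' u v) u
    (isClosed_eq (by fun_prop) (by fun_prop)) fun x => ?_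
  exact he.induction_on (p := fun v => B (e x) v = B' (e x) v) v
    (isClosed_eq (by fun_prop) (by fun_prop)) fun y => h x y

theorem tendsto_inner_zero_of_bounded {E : Type*} [NormedAddCommGroup E] [InnerProductSpace ℂ E]
    {u v : ℕ → E} {C : ℝ} (hu : Tendsto u atTop (𝓝 0))
    (hv : ∀ n, ‖v n‖ ≤ C) : Tendsto (fun n => inner ℂ (v n) (u n)) atTop (𝓝 0) := by
  refine squeeze_zero_norm (a := fun n => C * ‖u n‖) (fun n => ?_) ?_
  · exact (norm_inner_le_norm _ _).trans (mul_le_mul_of_nonneg_right (hv n) (norm_nonneg _))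
  · simpa using hu.norm.const_mul C

theorem exists_norm_le_of_weaklyNull {v : ℕ → E}
    (hv : ∀ y, Tendsto (fun n => inner ℂ y (v n)) atTop (𝓝 0)) : ∃ C, ∀ n, ‖v n‖ ≤ C := by
  obtain ⟨C, hC⟩ := banach_steinhaus (g := fun n => innerSL ℂ (v n)) fun y => by
    obtain ⟨C, hC⟩ := (hv y).norm.bddAbove_range
    refine ⟨C, fun n => ?_⟩
    rw [innerSL_apply_apply, norm_inner_symm]
    exact hC ⟨n, rfl⟩
  exact ⟨C, fun n => by simpa using hC n⟩

/-- The isometry is moved across: `⟨M e v, M e u⟩ = ⟨v, e⁻¹ M*M e u⟩`. The second argument converges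
strongly to `z`, and `v n` is weakly null, hence bounded. -/
theorem tendsto_formPert_of_weaklyNull {e : ℕ → E ≃ₗᵢ[ℂ] E} {v : ℕ → E} {u u₀ : E}
    (hv : ∀ y, Tendsto (fun n => inner ℂ y (v n)) atTop (𝓝 0))
    (hu : Tendsto (fun n => e n u) atTop (𝓝 u₀))
    (he : ∀ y, ∃ z, Tendsto (fun n => (e n).symm y) atTop (𝓝 z)) :
    Tendsto (fun n => formPert M (e n u) (e n (v n))) atTop (𝓝 0) := by
  obtain ⟨C, hC⟩ := exists_norm_le_of_weaklyNull hv
  set T := M.adjoint ∘L M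
  obtain ⟨z, hz⟩ := he (T u₀)
  have h1 : Tendsto (fun n => (e n).symm (T (e n u)) - z) atTop (𝓝 0) := by
    have h2 : Tendsto (fun n => (e n).symm (T (e n u) - T u₀)) atTop (𝓝 0) := by
      rw [tendsto_zero_iff_norm_tendsto_zero]
      simp only [LinearIsometryEquiv.norm_map]
      rw [← tendsto_zero_iff_norm_tendsto_zero, ← sub_self (T u₀)]
      exact ((T.continuous.tendsto _).comp hu).sub_const _
    have h3 := h2.add (hz.sub_const z)
    simpa using h3
  have h4 := (tendsto_inner_zero_of_bounded h1 hC).add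
    (by simpa using (hv z).star : Tendsto (fun n => inner ℂ (v n) z) atTop (𝓝 0))
  rw [add_zero] at h4
  refine h4.congr fun n => ?_
  rw [← inner_add_right, sub_add_cancel, ← (e n).inner_map_map, LinearIsometryEquiv.apply_symm_apply]
  rfl

end Abstract

/-! ### Identification of the Schrödinger operator with the form operator -/

section Graph

variable {d : ℕ}

theorem IsTest.partialDeriv {φ : Space d → ℝ} (h : IsTest φ) (j : Fin d) :
    IsTest (partialDeriv j φ) :=
  ⟨(h.1.fderiv_right (m := ∞) (by simp)).clm_apply contDiff_const,
    h.hasCompactSupport_partialDeriv j⟩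

theorem IsTest.laplacian_eq {φ : Space d → ℝ} (h : IsTest φ) (x : Space d) :
    Δ φ x = ∑ j, Profile.partialDeriv j (Profile.partialDeriv j φ) x := by
  rw [InnerProductSpace.laplacian_eq_iteratedFDeriv_orthonormalBasis φ
    (EuclideanSpace.basisFun (Fin d) ℝ)]
  refine Finset.sum_congr rfl fun j _ => ?_
  rw [iteratedFDeriv_two_apply]
  have hd : DifferentiableAt ℝ (fderiv ℝ φ) x :=
    (h.1.fderiv_right (m := ∞) (by simp)).differentiable (by simp) x
  have e : Profile.partialDeriv j φ = fun y => fderiv ℝ φ y (EuclideanSpace.single j 1) := rfl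
  rw [Profile.partialDeriv, e, fderiv_clm_apply hd (differentiableAt_const _)]
  simp

theorem IsTest.inner_toL2 {φ : Space d → ℝ} (h : IsTest φ) (u : L2 d) :
    inner ℂ h.isCTest.toL2 u = ∫ x, φ x • u x := by
  rw [← testPairing_apply φ h.1.continuous h.2]
  rfl

theorem IsTest.derivL2_eq {φ : Space d → ℝ} (h : IsTest φ) (j : Fin d) :
    h.isCTest.derivL2 j = (h.partialDeriv j).isCTest.toL2 := by
  refine Lp.ext ?_
  filter_upwards [h.isCTest.coeFn_derivL2 j, (h.partialDeriv j).isCTest.coeFn_toL2] with x h1 h2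
  rw [h1, h2]
  have h3 : HasFDerivAt (fun y => (φ y : ℂ)) (Complex.ofRealCLM.comp (fderiv ℝ φ x)) x :=
    Complex.ofRealCLM.hasFDerivAt.comp x (h.1.differentiable (by simp) x).hasFDerivAt
  rw [h3.fderiv]
  rfl

/-- The derivative of `w` is paired with `∂_jφ`, again a test function, so the definition of the
weak derivative moves the second derivative onto `φ`. -/
theorem IsTest.inner_toH1 {φ : Space d → ℝ} (h : IsTest φ) (w : H1 d) :
    inner ℂ h.isCTest.toH1 w = (∫ x, -(Δ φ x) • w.toL2 x) + ∫ x, φ x • w.toL2 x := by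
  have hj : ∀ j, inner ℂ (h.isCTest.toH1.deriv j) (w.deriv j)
      = - ∫ x, Profile.partialDeriv j (Profile.partialDeriv j φ) x • w.toL2 x := by
    intro j
    have h1 : h.isCTest.toH1.deriv j = h.isCTest.derivL2 j := rfl
    have h2 : IsWeakPartial j w.toL2 (w.deriv j) := w.2 j
    rw [h1, h.derivL2_eq, (h.partialDeriv j).inner_toL2, h2 _ (h.partialDeriv j), neg_neg]
  have h0 : h.isCTest.toH1.toL2 = h.isCTest.toL2 := rfl
  rw [H1.inner_eq, h0, h.inner_toL2, add_comm]
  congr 1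
  simp only [hj, h.laplacian_eq, neg_smul, Finset.sum_smul]
  rw [integral_neg, Finset.sum_neg_distrib, integral_finsetSum]
  intro j _
  exact L2.integrable_smul _ ((h.partialDeriv j).continuous_partialDeriv j)
    ((h.partialDeriv j).hasCompactSupport_partialDeriv j)

variable {V : Space d → ℝ}

theorem locallyIntegrable_smul (hV : Continuous V) (u : L2 d) :
    LocallyIntegrable (fun x => V x • u x) :=
  ((Lp.memLp u).locallyIntegrable (by norm_num)).continuous_smul hV

theorem IsTest.inner_sobolevMul (hd : 3 ≤ d) (hV0 : ∀ x, 0 ≤ V x)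
    (hV : MemLp (fun x => Real.sqrt (V x)) d volume) {φ : Space d → ℝ} (h : IsTest φ) (w : H1 d) :
    inner ℂ (sobolevMul hd _ hV h.isCTest.toH1) (sobolevMul hd _ hV w)
      = ∫ x, φ x • (V x • w.toL2 x) := by
  rw [L2.inner_def]
  refine integral_congr_ae ?_
  have h0 : h.isCTest.toH1.toL2 = h.isCTest.toL2 := rfl
  filter_upwards [coeFn_sobolevMul hd hV h.isCTest.toH1, coeFn_sobolevMul hd hV w,
    h.isCTest.coeFn_toL2] with x h1 h2 h3
  rw [h1, h2, h0, h3]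
  simp only [RCLike.inner_apply, Complex.real_smul, map_mul, Complex.conj_ofReal]
  have e : (Real.sqrt (V x) : ℂ) * Real.sqrt (V x) = V x := by
    exact_mod_cast Real.mul_self_sqrt (hV0 x)
  linear_combination ((φ x : ℂ) * w.toL2 x) * e

theorem IsTest.form_eq (hd : 3 ≤ d) (hVc : Continuous V) (hV0 : ∀ x, 0 ≤ V x)
    (hV : MemLp (fun x => Real.sqrt (V x)) d volume) {φ : Space d → ℝ} (h : IsTest φ) (w : H1 d) :
    inner ℂ h.isCTest.toH1 w + inner ℂ (sobolevMul hd _ hV h.isCTest.toH1) (sobolevMul hd _ hV w)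
      = (∫ x, (-(Δ φ x) • w.toL2 x + φ x • (V x • w.toL2 x))) + ∫ x, φ x • w.toL2 x := by
  have i1 : Integrable fun x => -(Δ φ x) • w.toL2 x :=
    L2.integrable_smul _ h.continuous_laplacian.neg h.hasCompactSupport_laplacian.neg
  have i2 : Integrable fun x => φ x • (V x • w.toL2 x) :=
    (locallyIntegrable_smul hVc w.toL2).integrable_smul_left_of_hasCompactSupport
      h.1.continuous h.2
  rw [h.inner_toH1, h.inner_sobolevMul hd hV0 hV, integral_add i1 i2]
  ring

theorem IsTest.inner_toL2L (φ : Space d → ℝ) (h : IsTest φ) (f u : L2 d) :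
    inner ℂ (H1.toL2L h.isCTest.toH1) (f + u) = (∫ x, φ x • f x) + ∫ x, φ x • u x := by
  have h0 : H1.toL2L h.isCTest.toH1 = h.isCTest.toL2 := rfl
  rw [h0, inner_add_right, h.inner_toL2, h.inner_toL2]

/-- The distributional equation, with `u` added to both sides, is the weak equation of the form
tested with real test functions. These are total in `H¹`, which gives the forward direction; the
converse only specialises the weak equation. -/
theorem mem_schrodingerGraph_iff (hd : 3 ≤ d) (hVc : Continuous V) (hV0 : ∀ x, 0 ≤ V x)
    (hV : MemLp (fun x => Real.sqrt (V x)) d volume) (u f : L2 d) :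
    (u, f) ∈ schrodingerGraph V ↔
      u = formResolvent H1.toL2L (sobolevMul hd _ hV) (f + u) := by
  constructor
  · rintro ⟨⟨w, hw⟩, -, hf⟩
    simp only at hw hf
    subst hw
    refine congrArg H1.toL2L (eq_formSolve_of_orthogonal
      (e := fun φ : {φ : Space d → ℝ // IsTest φ} => φ.2.isCTest.toH1)
      (fun y hy => H1.eq_zero_of_inner_isTest fun φ hφ => hy ⟨φ, hφ⟩) fun φ => ?_)
    exact (φ.2.form_eq hd hVc hV0 hV w).trans ((congrArg (· + _) (hf φ φ.2)).trans
      (φ.2.inner_toL2L φ f w.toL2).symm)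
  · intro h
    obtain ⟨w, hw⟩ : ∃ w, w = formSolve H1.toL2L (sobolevMul hd _ hV) (f + u) := ⟨_, rfl⟩
    have hwu : w.toL2 = u := by rw [hw]; exact h.symm
    refine ⟨⟨w, hwu⟩, locallyIntegrable_smul hVc u, fun φ hφ => ?_⟩
    have h1 := hφ.form_eq hd hVc hV0 hV w
    have h2 := inner_formSolve (J := H1.toL2L) (M := sobolevMul hd _ hV) hφ.isCTest.toH1 (f + u)
    rw [← hw, h1, hφ.inner_toL2L φ f u, hwu] at h2
    exact add_right_cancel h2

theorem mem_schrodingerOp_graph_iff (hd : 3 ≤ d) (hVc : Continuous V) (hV0 : ∀ x, 0 ≤ V x)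
    (hV : MemLp (fun x => Real.sqrt (V x)) d volume) (u f : L2 d) :
    (u, f) ∈ (schrodingerOp V).graph ↔
      u = formResolvent H1.toL2L (sobolevMul hd _ hV) (f + u) := by
  rw [schrodingerOp_graph, mem_schrodingerGraph_iff hd hVc hV0 hV]

end Graph

/-! ### Conjugation by unitary operators -/

section Conjugation

variable {H E K : Type*} [NormedAddCommGroup H] [InnerProductSpace ℂ H] [CompleteSpace H]
  [NormedAddCommGroup E] [InnerProductSpace ℂ E] [CompleteSpace E]
  [NormedAddCommGroup K] [InnerProductSpace ℂ K] [CompleteSpace K]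
  {J : E →L[ℂ] H} {M : E →L[ℂ] K}

/-- Substituting `eE v` in the weak equation changes nothing but `M`: translating the profile
amounts to translating the potential the other way. -/
theorem formResolvent_conj (eE : E ≃ₗᵢ[ℂ] E) (eH : H ≃ₗᵢ[ℂ] H) (he : ∀ v, J (eE v) = eH (J v))
    (f : H) : formResolvent J (M ∘L (eE : E →L[ℂ] E)) f = eH.symm (formResolvent J M (eH f)) := by
  obtain ⟨w, hw⟩ := eE.surjective (formSolve J M (eH f))
  have h1 : w = formSolve J (M ∘L (eE : E →L[ℂ] E)) f := eq_formSolve fun v => by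
    have h2 := inner_formSolve (J := J) (M := M) (eE v) (eH f)
    rw [← hw, he, eE.inner_map_map, eH.inner_map_map] at h2
    exact h2
  rw [formResolvent_apply, formResolvent_apply, ← h1, ← hw, he, LinearIsometryEquiv.symm_apply_apply]

/-- Convergence of the conjugated groups if the conjugated perturbations tend to zero. -/
theorem exists_tendsto_resolventGroup_conj_lift (hJ : ‖J‖ ≤ 1) (hinj : Function.Injective J)
    (hJd : DenseRange J) {eE : ℕ → E ≃ₗᵢ[ℂ] E} {eH : ℕ → H ≃ₗᵢ[ℂ] H}
    (he : ∀ n v, J (eE n v) = eH n (J v))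
    (h : ∀ v, Tendsto (fun n => M (eE n v)) atTop (𝓝 0)) {t : ℕ → ℝ} {s : ℝ}
    (ht : Tendsto t atTop (𝓝 s)) (v : E) : ∃ (φ : E) (w : ℕ → E),
      (∀ n, J (w n) =
        (eH n).symm (resolventGroup (formResolvent J M) (t n) (eH n (J v)))) ∧
      Tendsto w atTop (𝓝 φ) := by
  obtain ⟨φ, w, hw, hφ⟩ := exists_tendsto_resolventGroup_lift hJ hinj hJd
    (M := fun n => M ∘L (eE n : E →L[ℂ] E)) (C := ‖M‖)
    (fun n => ContinuousLinearMap.opNorm_le_bound _ (norm_nonneg _) fun v => by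
      simpa using M.le_opNorm (eE n v)) h ht v
  refine ⟨φ, w, fun n => ?_, hφ⟩
  rw [hw n]
  exact resolventGroup_conj (eH n) formResolvent_nonneg (formResolvent_le_one hJ)
    (denseRange_formResolvent hinj hJd) formResolvent_nonneg (formResolvent_le_one hJ)
    (denseRange_formResolvent hinj hJd) (formResolvent_conj (eE n) (eH n) (he n)) _ _

/-- Conservation of the form: `‖w'‖² ≤ ‖w‖² + ‖M w‖² ≤ (1 + ‖M‖)² ‖w‖²`. The constant does not
depend on `t`, as the decay argument requires. -/
theorem exists_resolventGroup_lift_norm_le (hJ : ‖J‖ ≤ 1) (hinj : Function.Injective J)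
    (hJd : DenseRange J) (t : ℝ) (w : E) : ∃ w' : E,
      J w' = resolventGroup (formResolvent J M) t (J w) ∧ ‖w'‖ ≤ (1 + ‖M‖) * ‖w‖ := by
  obtain ⟨w', h1, h2⟩ := exists_resolventGroup_lift (M := M) hJ hinj hJd t w
  refine ⟨w', h1, abs_le_of_sq_le_sq' ?_ (by positivity) |>.2⟩
  have h3 : ‖M w‖ ^ 2 ≤ (‖M‖ * ‖w‖) ^ 2 := by gcongr; exact M.le_opNorm w
  nlinarith [sq_nonneg ‖M w'‖, norm_nonneg M, sq_nonneg ‖w‖,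
    mul_nonneg (norm_nonneg M) (sq_nonneg ‖w‖)]

end Conjugation

/-! ### The abstract results applied to `-Δ + V` -/

section Schrodinger

variable {d : ℕ} {V : Space d → ℝ}

/-- The operator `(1 + A)⁻¹`. -/
def schrodingerResolvent (hd : 3 ≤ d) (hV : MemLp (fun x => Real.sqrt (V x)) d volume) :
    L2 d →L[ℂ] L2 d := formResolvent H1.toL2L (sobolevMul hd _ hV)

theorem schrodingerResolvent_nonneg (hd : 3 ≤ d) (hV : MemLp (fun x => Real.sqrt (V x)) d volume) :
    0 ≤ schrodingerResolvent hd hV := formResolvent_nonneg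

theorem schrodingerResolvent_le_one (hd : 3 ≤ d) (hV : MemLp (fun x => Real.sqrt (V x)) d volume) :
    schrodingerResolvent hd hV ≤ 1 :=
  formResolvent_le_one H1.norm_toL2L_le

theorem denseRange_schrodingerResolvent (hd : 3 ≤ d) (hV : MemLp (fun x => Real.sqrt (V x)) d volume) :
    DenseRange (schrodingerResolvent hd hV) :=
  denseRange_formResolvent (H1.toL2_injective d) denseRange_toL2L

theorem isSelfAdjoint_schrodingerOp (hd : 3 ≤ d) (hVc : Continuous V) (hV0 : ∀ x, 0 ≤ V x)
    (hV : MemLp (fun x => Real.sqrt (V x)) d volume) :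
    IsSelfAdjoint (schrodingerOp V) :=
  isSelfAdjoint_of_resolvent (schrodingerResolvent_nonneg hd hV)
    (denseRange_schrodingerResolvent hd hV) (mem_schrodingerOp_graph_iff hd hVc hV0 hV)

theorem isUnitaryGroupOf_schrodingerOp (hd : 3 ≤ d) (hVc : Continuous V) (hV0 : ∀ x, 0 ≤ V x)
    (hV : MemLp (fun x => Real.sqrt (V x)) d volume) :
    IsUnitaryGroupOf (schrodingerOp V) (resolventGroup (schrodingerResolvent hd hV)) :=
  isUnitaryGroupOf_resolventGroup (schrodingerResolvent_nonneg hd hV)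
    (schrodingerResolvent_le_one hd hV) (denseRange_schrodingerResolvent hd hV)
    (mem_schrodingerOp_graph_iff hd hVc hV0 hV)

theorem expI_schrodingerOp (hd : 3 ≤ d) (hVc : Continuous V) (hV0 : ∀ x, 0 ≤ V x)
    (hV : MemLp (fun x => Real.sqrt (V x)) d volume) :
    expI (schrodingerOp V) = resolventGroup (schrodingerResolvent hd hV) :=
  expI_eq (dense_domain_of_resolvent (denseRange_schrodingerResolvent hd hV)
    (mem_schrodingerOp_graph_iff hd hVc hV0 hV)) (isUnitaryGroupOf_schrodingerOp hd hVc hV0 hV)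

theorem normEquivalence_schrodingerOp (hd : 3 ≤ d) (hVc : Continuous V) (hV0 : ∀ x, 0 ≤ V x)
    (hV : MemLp (fun x => Real.sqrt (V x)) d volume) :
    NormEquivalence (schrodingerOp V) := by
  refine ⟨1, 1 + ‖sobolevMul hd _ hV‖ ^ 2, one_pos, by positivity, fun u => ?_⟩
  obtain ⟨w, h1, h2, h3⟩ := form_bounds
    ((mem_schrodingerOp_graph_iff hd hVc hV0 hV _ _).1 ((schrodingerOp V).mem_graph u))
  exact ⟨w, h1, by rwa [one_mul], h3⟩

theorem isFormB_formPert (hd : 3 ≤ d) (hVc : Continuous V) (hV0 : ∀ x, 0 ≤ V x)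
    (hV : MemLp (fun x => Real.sqrt (V x)) d volume) :
    IsFormB (schrodingerOp V) (formPert (sobolevMul hd _ hV)) :=
  fun u _ hu _ => formPert_eq (J := H1.toL2L) (H1.toL2_injective d)
    ((mem_schrodingerOp_graph_iff hd hVc hV0 hV _ _).1 ((schrodingerOp V).mem_graph ⟨u.toL2, hu⟩))

/-- The weak solutions lie in `D(A)` and are dense in `H¹`, not merely in `L²`, so a bounded form is
determined by its values on them. -/
theorem eq_formPert_of_isFormB (hd : 3 ≤ d) (hVc : Continuous V) (hV0 : ∀ x, 0 ≤ V x)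
    (hV : MemLp (fun x => Real.sqrt (V x)) d volume)
    {B : H1 d →L[ℂ] H1 d →L⋆[ℂ] ℂ}
    (hB : IsFormB (schrodingerOp V) B) :
    B = formPert (sobolevMul hd _ hV) := by
  have hr : ∀ f, (formSolve H1.toL2L (sobolevMul hd _ hV) f).toL2 ∈ (schrodingerOp V).domain :=
    fun f => LinearPMap.mem_domain_of_mem_graph
      (apply_mem_graph (mem_schrodingerOp_graph_iff hd hVc hV0 hV) f)
  refine eq_of_eqOn_denseRange (denseRange_formSolve (J := H1.toL2L) (M := sobolevMul hd _ hV)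
    (H1.toL2_injective d)) fun f g => ?_
  exact (hB _ _ (hr f) (hr g)).trans (isFormB_formPert hd hVc hV0 hV _ _ (hr f) (hr g)).symm

theorem WeaklyNullH1.tendsto_inner {h : ℕ → H1 d} (hh : WeaklyNullH1 h) (y : H1 d) :
    Tendsto (fun n => inner ℂ y (h n)) atTop (𝓝 0) := hh (innerSL ℂ y)

theorem tendsto_formPert_translate_atInfinity (hd : 3 ≤ d)
    (hV : MemLp (fun x => Real.sqrt (V x)) d volume) {x : ℕ → Space d} {h : ℕ → H1 d} {C : ℝ}
    (hx : Tendsto (fun n => ‖x n‖) atTop atTop) (hh : ∀ n, ‖h n‖ ≤ C) (ψ : H1 d) :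
    Tendsto (fun n => formPert (sobolevMul hd _ hV) (H1.translate (x n) ψ)
      (H1.translate (x n) (h n))) atTop (𝓝 0) := by
  simp only [formPert_apply]
  refine tendsto_inner_zero_of_bounded (C := ‖sobolevMul hd _ hV‖ * C)
    (tendsto_sobolevMul_translate hd hV hx ψ) fun n => ?_
  refine ContinuousLinearMap.le_opNorm_of_le _ ?_
  rw [H1.norm_translate]
  exact hh n

theorem tendsto_formPert_translate_atFinite (hd : 3 ≤ d)
    (hV : MemLp (fun x => Real.sqrt (V x)) d volume) {x : ℕ → Space d} {h : ℕ → H1 d} {x₀ : Space d}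
    (hx : Tendsto x atTop (𝓝 x₀)) (hh : WeaklyNullH1 h) (ψ : H1 d) :
    Tendsto (fun n => formPert (sobolevMul hd _ hV) (H1.translate (x n) ψ)
      (H1.translate (x n) (h n))) atTop (𝓝 0) :=
  tendsto_formPert_of_weaklyNull (e := fun n => H1.translateL (x n)) hh.tendsto_inner
    (((H1.continuous_translate ψ).tendsto x₀).comp hx) fun y =>
      ⟨_, ((H1.continuous_translate y).tendsto (-x₀)).comp hx.neg⟩

theorem formVanishing_schrodingerOp (hd : 3 ≤ d) (hVc : Continuous V) (hV0 : ∀ x, 0 ≤ V x)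
    (hV : MemLp (fun x => Real.sqrt (V x)) d volume) :
    FormVanishing (schrodingerOp V) := by
  refine ⟨⟨formPert (sobolevMul hd _ hV), isFormB_formPert hd hVc hV0 hV,
    fun B hB => eq_formPert_of_isFormB hd hVc hV0 hV hB⟩, fun B hB x h hx ψ => ?_⟩
  have e := eq_formPert_of_isFormB hd hVc hV0 hV hB
  subst e
  rcases hx with ⟨hx, C, hC⟩ | ⟨⟨x₀, hx⟩, hh⟩
  · exact tendsto_formPert_translate_atInfinity hd hV hx hC ψ
  · exact tendsto_formPert_translate_atFinite hd hV hx hh ψ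

theorem convergenceAtInfinity_schrodingerOp (hd : 3 ≤ d) (hVc : Continuous V) (hV0 : ∀ x, 0 ≤ V x)
    (hV : MemLp (fun x => Real.sqrt (V x)) d volume) :
    ConvergenceAtInfinity (schrodingerOp V) := by
  intro t x s ht hx ψ
  rw [expI_schrodingerOp hd hVc hV0 hV]
  obtain ⟨φ, w, hw, hφ⟩ := exists_tendsto_resolventGroup_conj_lift (J := H1.toL2L)
    (M := sobolevMul hd _ hV) (eE := fun n => H1.translateL (x n)) (eH := fun n => translateL (x n))
    H1.norm_toL2L_le (H1.toL2_injective d) denseRange_toL2L (fun _ _ => rfl)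
    (tendsto_sobolevMul_translate hd hV hx) ht ψ
  exact ⟨φ, w, hw, hφ⟩

theorem convergenceAtFinite_schrodingerOp (hd : 3 ≤ d) (hVc : Continuous V) (hV0 : ∀ x, 0 ≤ V x)
    (hV : MemLp (fun x => Real.sqrt (V x)) d volume) :
    ConvergenceAtFinite (schrodingerOp V) := by
  intro t x s x₀ ht hx ψ
  rw [expI_schrodingerOp hd hVc hV0 hV]
  obtain ⟨φ, w, h0, hw, hφ⟩ := exists_tendsto_resolventGroup_of_tendsto (J := H1.toL2L)
    (M := sobolevMul hd _ hV) H1.norm_toL2L_le (H1.toL2_injective d) denseRange_toL2L ht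
    (((H1.continuous_translate ψ).tendsto x₀).comp hx)
  exact ⟨φ, h0, w, hw, hφ⟩

end Schrodinger

/-! ### Decay in `L^p` -/

section Decay

variable {d : ℕ}

theorem lintegral_sq_eq (u : L2 d) : ∫⁻ x, ‖u x‖ₑ ^ (2 : ℝ) = ENNReal.ofReal ‖u‖ ^ (2 : ℝ) := by
  rw [← eLpNorm_rpow_eq two_pos, ← L2.eLpNorm_eq, ENNReal.ofReal_ofNat]

/-- Interpolation between `L²` and `L^∞`: `|u|^p ≤ ‖u‖_∞^{p-2} |u|²` almost everywhere. -/
theorem eLpNorm_rpow_le_top_mul (u : L2 d) {p : ℝ} (hp : 2 < p) :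
    eLpNorm u (ENNReal.ofReal p) volume ^ p
      ≤ eLpNorm u ∞ volume ^ (p - 2) * ENNReal.ofReal ‖u‖ ^ (2 : ℝ) := by
  rw [eLpNorm_rpow_eq (by linarith), ← lintegral_sq_eq, ← lintegral_const_mul'' _
    ((Lp.aestronglyMeasurable u).enorm.pow_const _)]
  refine lintegral_mono_ae ?_
  filter_upwards [ae_le_eLpNormEssSup (f := u) (μ := volume)] with x hx
  have e : p = (p - 2) + 2 := by ring
  conv_lhs => rw [e, ENNReal.rpow_add_of_nonneg _ _ (by linarith) (by norm_num)]
  rw [eLpNorm_exponent_top]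
  gcongr

theorem tendsto_of_tendsto_rpow {f : ℕ → ℝ≥0∞} {p : ℝ} (hp : 0 < p)
    (h : Tendsto (fun n => f n ^ p) atTop (𝓝 0)) : Tendsto f atTop (𝓝 0) := by
  have h2 := ((ENNReal.continuous_rpow_const (y := p⁻¹)).tendsto 0).comp h
  rw [ENNReal.zero_rpow_of_pos (inv_pos.2 hp)] at h2
  exact h2.congr fun n => ENNReal.rpow_rpow_inv hp.ne' _

theorem tendsto_eLpNorm_of_tendsto_top {u : ℕ → L2 d} {C p : ℝ} (hp : 2 < p)
    (hC : ∀ n, ‖u n‖ ≤ C) (hu : Tendsto (fun n => eLpNorm (u n) ∞ volume) atTop (𝓝 0)) :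
    Tendsto (fun n => eLpNorm (u n) (ENNReal.ofReal p) volume) atTop (𝓝 0) := by
  refine tendsto_of_tendsto_rpow (p := p) (by linarith) ?_
  have h1 := ((ENNReal.continuous_rpow_const (y := p - 2)).tendsto 0).comp hu
  rw [ENNReal.zero_rpow_of_pos (by linarith)] at h1
  have h2 := ENNReal.Tendsto.mul_const (b := ENNReal.ofReal C ^ (2 : ℝ)) h1
    (.inr (ENNReal.rpow_ne_top_of_nonneg (by norm_num) ENNReal.ofReal_ne_top))
  rw [zero_mul] at h2
  refine tendsto_of_tendsto_of_tendsto_of_le_of_le tendsto_const_nhds h2 (fun _ => zero_le)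
    fun n => (eLpNorm_rpow_le_top_mul (u n) hp).trans ?_
  dsimp only [Function.comp_apply]
  gcongr
  exact hC n

/-- A modulus of continuity for the embedding `H¹ ⊂ L^p`. -/
def embeddingModulus (d : ℕ) (S : NNReal) (p r : ℝ) : ℝ≥0∞ :=
  (ENNReal.ofReal r ^ (2 : ℝ) + (S * ENNReal.ofReal r) ^ (sobolevExp d : ℝ)) ^ p⁻¹

theorem tendsto_embeddingModulus (hd : 3 ≤ d) (S : NNReal) {p : ℝ} (hp : 0 < p) :
    Tendsto (embeddingModulus d S p) (𝓝 0) (𝓝 0) := by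
  have hq : (0 : ℝ) < sobolevExp d := sobolevExp_pos hd
  have hc : Continuous (embeddingModulus d S p) := by
    refine ENNReal.continuous_rpow_const.comp (Continuous.add ?_ ?_)
    · exact ENNReal.continuous_rpow_const.comp ENNReal.continuous_ofReal
    · exact ENNReal.continuous_rpow_const.comp
        ((ENNReal.continuous_const_mul ENNReal.coe_ne_top).comp ENNReal.continuous_ofReal)
  have h0 : embeddingModulus d S p 0 = 0 := by
    simp [embeddingModulus, hp, hq]
  simpa only [h0] using hc.tendsto 0

theorem embeddingModulus_mono (S : NNReal) {p : ℝ} (hp : 0 < p) :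
    Monotone (embeddingModulus d S p) := fun r s h => by
  unfold embeddingModulus
  gcongr

/-- From `|u|^p ≤ |u|² + |u|^{2⋆}` pointwise. The bound is not homogeneous in `‖w‖`, but a modulus
vanishing at `0` is all that the approximation argument uses. -/
theorem H1.eLpNorm_le (hd : 3 ≤ d) {p : ℝ} (h2 : 2 ≤ p) (hp : p ≤ sobolevExp d) (w : H1 d) :
    eLpNorm w.toL2 (ENNReal.ofReal p) volume ≤ embeddingModulus d (sobolevConst hd) p ‖w‖ := by
  have hp0 : 0 < p := by linarith
  rw [embeddingModulus, ENNReal.le_rpow_inv_iff hp0, eLpNorm_rpow_eq hp0]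
  refine (lintegral_rpow_le_add (Lp.aestronglyMeasurable w.toL2) h2 hp).trans ?_
  rw [lintegral_sq_eq, ← eLpNorm_rpow_eq (lt_of_lt_of_le hp0 hp), ENNReal.ofReal_coe_nnreal]
  gcongr
  · exact w.norm_toL2_le
  · exact w.eLpNorm_sobolev_le hd

theorem le_sobolevExp (hd : 3 ≤ d) {p : ℝ} (hp : ((d : ℝ) - 2) * p ≤ 2 * d) :
    p ≤ sobolevExp d := by
  have h3 : (3 : ℝ) ≤ d := by exact_mod_cast hd
  have h := inv_sobolevExp hd
  rw [inv_eq_iff_eq_inv] at h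
  have e : ((2 : ℝ)⁻¹ - (d : ℝ)⁻¹)⁻¹ = 2 * d / (d - 2) := by
    rw [inv_sub_inv two_ne_zero (by positivity), inv_div]
  rw [h, e, le_div_iff₀ (by linarith)]
  linarith

theorem eLpNorm_translate_eq (a : Space d) (f : L2 d) (p : ℝ≥0∞) :
    eLpNorm (translate a f) p volume = eLpNorm f p volume := by
  rw [eLpNorm_congr_ae (coeFn_translate a f)]
  exact eLpNorm_comp_measurePreserving (Lp.aestronglyMeasurable f)
    (measurePreserving_sub_right volume a)

theorem tendsto_dispersive_factor (hd : 3 ≤ d) (C : ℝ) {t : ℕ → ℝ}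
    (ht : Tendsto (fun n => |t n|) atTop atTop) {L : ℝ≥0∞} (hL : L ≠ ⊤) :
    Tendsto (fun n => ENNReal.ofReal (C * |t n| ^ (-(d / 2 : ℝ))) * L) atTop (𝓝 0) := by
  have hd' : (0 : ℝ) < d / 2 := by positivity
  have h1 := ((tendsto_rpow_neg_atTop hd').comp ht).const_mul C
  have h2 := ENNReal.tendsto_ofReal h1
  rw [mul_zero, ENNReal.ofReal_zero] at h2
  have h3 := ENNReal.Tendsto.mul_const (b := L) h2 (.inr hL)
  rwa [zero_mul] at h3

/-- Translation preserves the `L¹` norm, so the dispersive bound is uniform in `x n`. -/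
theorem tendsto_eLpNorm_top_of_dispersive (hd : 3 ≤ d) {A : L2 d →ₗ.[ℂ] L2 d}
    (hA : DispersiveEstimate A) {t : ℕ → ℝ} (ht : Tendsto (fun n => |t n|) atTop atTop)
    (x : ℕ → Space d) {f : L2 d} (hf : MemLp f 1 volume) :
    Tendsto (fun n => eLpNorm (expI A (t n) (translate (x n) f)) ∞ volume) atTop (𝓝 0) := by
  obtain ⟨C, hC⟩ := hA
  refine tendsto_of_tendsto_of_tendsto_of_le_of_le' tendsto_const_nhds
    (tendsto_dispersive_factor hd C ht hf.2.ne) (.of_forall fun _ => zero_le) ?_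
  filter_upwards [ht.eventually_gt_atTop 0] with n hn
  rw [← eLpNorm_translate_eq (x n) f]
  exact hC (t n) (abs_pos.1 hn) _ ⟨Lp.aestronglyMeasurable _, by
    rw [eLpNorm_translate_eq]; exact hf.2⟩

theorem IsCTest.memLp_toL2 {f : Space d → ℂ} (h : IsCTest f) (p : ℝ≥0∞) :
    MemLp h.toL2 p volume :=
  (memLp_of_compactSupport h.1.continuous h.2 p).ae_eq h.coeFn_toL2.symm

/-- Decay in `L^p` for a group that is bounded on `H¹` and disperses on a dense subset. -/
theorem decayLp_of_dispersive (hd : 3 ≤ d) {A : L2 d →ₗ.[ℂ] L2 d} (hA : DispersiveEstimate A)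
    (hn : ∀ t u, ‖expI A t u‖ = ‖u‖) {C : ℝ}
    (hlift : ∀ t (w : H1 d), ∃ w' : H1 d, w'.toL2 = expI A t w.toL2 ∧ ‖w'‖ ≤ C * ‖w‖) :
    DecayLp A := by
  intro t x ht p h2 hp ψ
  have hq := le_sobolevExp hd hp
  have hp0 : 0 < p := by linarith
  rw [ENNReal.tendsto_nhds_zero]
  intro ε hε
  have hε2 : 0 < ε / 2 := ENNReal.half_pos hε.ne'
  -- The test function is chosen before `n`: the `L^p` norm of the evolved remainder is bounded by
  -- this modulus for all times and translations at once.
  have hlim : Tendsto (fun w : H1 d => embeddingModulus d (sobolevConst hd) p (C * ‖ψ - w‖))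
      (𝓝 ψ) (𝓝 0) := by
    refine (tendsto_embeddingModulus hd _ hp0).comp ?_
    have : Continuous fun w : H1 d => C * ‖ψ - w‖ := by fun_prop
    simpa using this.tendsto ψ
  obtain ⟨w, hw, f, hf, rfl⟩ := (mem_closure_iff_nhds.1 (dense_testSubmodule (d := d) ψ)) _
    (hlim.eventually (gt_mem_nhds hε2))
  have h3 := tendsto_eLpNorm_of_tendsto_top h2
    (fun n => (hn (t n) (translate (x n) hf.toL2)).trans (norm_translate _ _) |>.le)
    (tendsto_eLpNorm_top_of_dispersive hd hA ht x (hf.memLp_toL2 1))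
  filter_upwards [ENNReal.tendsto_nhds_zero.1 h3 _ hε2] with n hn3
  -- The evolved remainder as an element of `H¹`; adding the evolved test function recovers the
  -- evolution of the translate of `ψ`.
  obtain ⟨w', hw', hb⟩ := hlift (t n) (H1.translate (x n) (ψ - hf.toH1))
  have e : expI A (t n) (translate (x n) ψ.toL2)
      = w'.toL2 + expI A (t n) (translate (x n) hf.toL2) := by
    rw [hw', ← map_add]
    congr 1
    have h4 := (translateL (x n)).map_add (ψ - hf.toH1).toL2 hf.toL2
    have h5 : (ψ - hf.toH1).toL2 + hf.toL2 = ψ.toL2 := sub_add_cancel ψ.toL2 hf.toL2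
    rw [h5] at h4
    exact h4
  rw [e, eLpNorm_congr_ae (Lp.coeFn_add _ _), ← ENNReal.add_halves ε]
  have h1p : 1 ≤ ENNReal.ofReal p := by
    rw [ENNReal.one_le_ofReal]; linarith
  refine (eLpNorm_add_le (Lp.aestronglyMeasurable _) (Lp.aestronglyMeasurable _) h1p).trans
    (add_le_add ?_ hn3)
  refine (w'.eLpNorm_le hd h2.le hq).trans ((embeddingModulus_mono _ hp0 ?_).trans hw.le)
  rwa [H1.norm_translate] at hb

theorem decayLp_schrodingerOp {V : Space d → ℝ} (hd : 3 ≤ d) (hVc : Continuous V)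
    (hV0 : ∀ x, 0 ≤ V x) (hV : MemLp (fun x => Real.sqrt (V x)) d volume)
    (hdisp : DispersiveEstimate (schrodingerOp V)) : DecayLp (schrodingerOp V) := by
  have e := expI_schrodingerOp hd hVc hV0 hV
  refine decayLp_of_dispersive hd hdisp (fun t u => ?_) (C := 1 + ‖sobolevMul hd _ hV‖)
    fun t w => ?_
  · rw [e]
    exact norm_resolventGroup_apply (schrodingerResolvent_nonneg hd hV)
      (schrodingerResolvent_le_one hd hV) (denseRange_schrodingerResolvent hd hV) t u
  · rw [e]
    exact exists_resolventGroup_lift_norm_le (J := H1.toL2L) H1.norm_toL2L_le (H1.toL2_injective d)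
      denseRange_toL2L t w

end Decay

end Profile

end

theorem proposition3p2 (d : ℕ) (hd : 3 ≤ d) (V : Profile.Space d → ℝ)
    (hV_smooth : ContDiff ℝ ∞ V) (hV_nonneg : ∀ x, 0 ≤ V x)
    (hV : MemLp V ((d : ℝ≥0∞) / 2) volume)
    (hV_grad : MemLp (gradient V) ((d : ℝ≥0∞) / 2) volume)
    (hdisp : Profile.DispersiveEstimate (Profile.schrodingerOp V)) :
    IsSelfAdjoint (Profile.schrodingerOp V) ∧
    Profile.IsUnitaryGroupOf (Profile.schrodingerOp V)
      (Profile.expI (Profile.schrodingerOp V)) ∧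
    Profile.NormEquivalence (Profile.schrodingerOp V) ∧
    Profile.FormVanishing (Profile.schrodingerOp V) ∧
    Profile.DecayLp (Profile.schrodingerOp V) ∧
    Profile.ConvergenceAtInfinity (Profile.schrodingerOp V) ∧
    Profile.ConvergenceAtFinite (Profile.schrodingerOp V) := by
  have hc := hV_smooth.continuous
  have hs := Profile.memLp_sqrt hV_nonneg hV
  refine ⟨Profile.isSelfAdjoint_schrodingerOp hd hc hV_nonneg hs, ?_,
    Profile.normEquivalence_schrodingerOp hd hc hV_nonneg hs,
    Profile.formVanishing_schrodingerOp hd hc hV_nonneg hs,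
    Profile.decayLp_schrodingerOp hd hc hV_nonneg hs hdisp,
    Profile.convergenceAtInfinity_schrodingerOp hd hc hV_nonneg hs,
    Profile.convergenceAtFinite_schrodingerOp hd hc hV_nonneg hs⟩
  rw [Profile.expI_schrodingerOp hd hc hV_nonneg hs]
  exact Profile.isUnitaryGroupOf_schrodingerOp hd hc hV_nonneg hs
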